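/- Let $N\ge 0$ and $y\ge 2$ be integers, $\Sigma=\{-1,+1\}^N$, $E:\Sigma\to\mathbb R$ with $\min E=0$, $\gamma>0$, and for $\boldsymbol\sigma=(\sigma^1,\dots,\sigma^y)\in\Sigma^y$ put $U(\boldsymbol\sigma)=\sum_{a=1}^y E(\sigma^a)$. Let $$\mu_0(\boldsymbol\sigma)=\frac1\Gamma\exp\Big(\sum_{i=1}^N\log\cosh\big(\gamma\sum_{a=1}^y\sigma_i^a\big)\Big),\qquad \overline Q_\beta(\boldsymbol\sigma)=\frac{1}{\hat\Gamma_\beta}e^{-\beta U(\boldsymbol\sigma)}\mu_0(\boldsymbol\sigma)$$ be probability measures on $\Sigma^y$ ($\Gamma,\hat\Gamma_\beta$ are normalizing constants). Let $\Pi_\gamma$ be the transition matrix on $\Sigma^y$ which picks a replica $a$ and a coordinate $i$ uniformly at random and flips $\sigma_i^a$, accepting the new configuration $\tilde{\boldsymbol\sigma}$ with probability $\min\big(1,\cosh(\gamma\sum_b\tilde\sigma_i^b)/\cosh(\gamma\sum_b\sigma_i^b)\big)$ and otherwise staying put. Let $S_\beta$ be the Metropolis–Hastings matrix with $S_\beta(\boldsymbol\sigma,\boldsymbol\tau)=e^{-\beta(U(\boldsymbol\tau)-U(\boldsymbol\sigma))^+}\,\Pi_\gamma(\boldsymbol\sigma,\boldsymbol\tau)$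 for $\boldsymbol\sigma\ne\boldsymbol\tau$ and diagonal entries making the rows sum to $1$. Let $$m=\max_{\boldsymbol\sigma,\boldsymbol\tau}\big(H(\boldsymbol\sigma,\boldsymbol\tau)-U(\boldsymbol\sigma)-U(\boldsymbol\tau)\big),\qquad H(\boldsymbol\sigma,\boldsymbol\tau)=\min_p\max_{\boldsymbol\rho\in p}U(\boldsymbol\rho),$$ where $p$ runs over the paths of single-spin flips from $\boldsymbol\sigma$ to $\boldsymbol\tau$. Let $B=\min\{E(\sigma):E(\sigma)\ne0\}$ (with $B=0$ if $E\equiv 0$). Let $0\le\beta_1\le\beta_2\le\cdots$, let $T_1,T_2,\ldots$ be non-negative integers, let $\nu_0$ be a probability measure on $\Sigma^y$ and $\nu_n=\nu_{n-1}S_{\beta_n}^{T_n}$ for $n\ge1$. Then there is a constant $\kappa_1>1$ with $$\|\overline Q_{\beta_n}-\overline Q_{\beta_{n+1}}\|_\infty\le\kappa_1e^{-\beta_nB}\quad\text{for all } n\ge1, \qquad (1)$$ and for every $\kappa_1>1$ satisfying (1) the following holds. If $$\lim_{n\to\infty}\Big[-\sum_{k=1}^nT_ke^{-\beta_km}+n\log\kappa_1\Big]=-\infty,$$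 then $\sum_{k=1}^nT_ke^{-\beta_km}\to\infty$ and $$\varepsilon_n:=\|\overline Q_{\beta_n}-\nu_n\|_\infty\to0.$$ If moreover $\beta_n\to\infty$, then $\nu_n$ and $\overline Q_{\beta_n}$ converge to the same probability measure $\overline Q_\infty$ on $\Sigma^y$; it vanishes outside $\mathcal N_0=\{\boldsymbol\sigma:U(\boldsymbol\sigma)=0\}$, and on $\mathcal N_0$ it equals $c\,\mu_0$ for a constant $c>0$. -/

import Mathlib

open Filter Topology

noncomputable section

namespace ReplicatedAnnealing

/-- A spin configuration in `{-1, +1}^N`; the units of `ℤ` are exactly `-1` and `+1`. -/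
abbrev Spin (N : ℕ) : Type := Fin N → ℤˣ

/-- A replica configuration `(σ^1, …, σ^y)`; `σ a i` is the `i`-th spin of the `a`-th replica. -/
abbrev Config (N y : ℕ) : Type := Fin y → Spin N

variable {N y : ℕ}

/-- The summed energy `∑_a E(σ^a)`. -/
def totalEnergy (E : Spin N → ℝ) (σ : Config N y) : ℝ := ∑ a, E (σ a)

/-- The sum `∑_a σ_i^a` of the `i`-th spins of all replicas. -/
def columnSum (σ : Config N y) (i : Fin N) : ℝ := ∑ a, ((σ a i : ℤ) : ℝ)

/-- The numerator `exp(∑_i log cosh(γ ∑_a σ_i^a))` of the reference measure. -/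
def weight (γ : ℝ) (σ : Config N y) : ℝ :=
  Real.exp (∑ i, Real.log (Real.cosh (γ * columnSum σ i)))

/-- The reference probability measure `μ₀`. -/
def mu0 (γ : ℝ) (σ : Config N y) : ℝ := weight γ σ / ∑ τ : Config N y, weight γ τ

/-- The measure `Q̄_β`: the Gibbs measure of the summed energy with reference measure `μ₀`. -/
def Qbar (E : Spin N → ℝ) (γ β : ℝ) (σ : Config N y) : ℝ :=
  Real.exp (-β * totalEnergy E σ) * mu0 γ σ /
    ∑ τ : Config N y, Real.exp (-β * totalEnergy E τ) * mu0 γ τ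

/-- Flip the `i`-th spin of the `a`-th replica. -/
def flip (σ : Config N y) (a : Fin y) (i : Fin N) : Config N y :=
  Function.update σ a (Function.update (σ a) i (-(σ a i)))

/-- Off-diagonal part of the proposal kernel `Π_γ`: a replica `a` and a coordinate `i` are picked
uniformly (probability `1 / (N y)`), and the flip is accepted with the Metropolis probability for
`μ₀`. At most one pair `(a, i)` contributes to the sum. -/
def proposalOff (γ : ℝ) (σ τ : Config N y) : ℝ :=
  ∑ a, ∑ i, if τ = flip σ a i then
    1 / ((N : ℝ) * (y : ℝ)) *
      min 1 (Real.cosh (γ * columnSum τ i) / Real.cosh (γ * columnSum σ i))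
  else 0

/-- The proposal kernel `Π_γ`, completed on the diagonal to a stochastic matrix. -/
def proposal (γ : ℝ) : Matrix (Config N y) (Config N y) ℝ := fun σ τ =>
  if τ = σ then 1 - ∑ ρ ∈ Finset.univ.erase σ, proposalOff γ σ ρ else proposalOff γ σ τ

/-- Off-diagonal part of the Metropolis–Hastings kernel at inverse temperature `β`: a move from `σ`
to `τ` proposed by `Π_γ` is accepted with probability `exp(-β (∑_a E(τ^a) - ∑_a E(σ^a))⁺)`. -/
def metropolisOff (E : Spin N → ℝ) (γ β : ℝ) (σ τ : Config N y) : ℝ :=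
  Real.exp (-β * max (totalEnergy E τ - totalEnergy E σ) 0) * proposal γ σ τ

/-- The transition matrix `S_β` of the Metropolis–Hastings chain. -/
def metropolis (E : Spin N → ℝ) (γ β : ℝ) : Matrix (Config N y) (Config N y) ℝ := fun σ τ =>
  if τ = σ then 1 - ∑ ρ ∈ Finset.univ.erase σ, metropolisOff E γ β σ ρ
  else metropolisOff E γ β σ τ

/-- The law `ν_n` of the annealing chain at time `T_1 + ⋯ + T_n`:
`ν_n = ν_{n-1} S_{β_n}^{T_n}`. -/
def law (E : Spin N → ℝ) (γ : ℝ) (β : ℕ → ℝ) (T : ℕ → ℕ) (ν₀ : Config N y → ℝ) :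
    ℕ → Config N y → ℝ
  | 0 => ν₀
  | n + 1 => Matrix.vecMul (law E γ β T ν₀ n) (metropolis E γ (β (n + 1)) ^ T (n + 1))

/-- The graph of elementary moves: two configurations are adjacent if one is obtained from the
other by flipping one spin of one replica. -/
def moveGraph (N y : ℕ) : SimpleGraph (Config N y) :=
  SimpleGraph.fromRel fun σ τ => ∃ a i, τ = flip σ a i

/-- The elevation of a path: the largest summed energy of its vertices. -/
def elev (E : Spin N → ℝ) {σ τ : Config N y} (p : (moveGraph N y).Walk σ τ) : ℝ :=
  p.support.toFinset.sup' ⟨σ, by simp⟩ (totalEnergy E)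

/-- The least elevation `H(σ, τ)` of a path from `σ` to `τ`. -/
def height (E : Spin N → ℝ) (σ τ : Config N y) : ℝ :=
  ⨅ p : (moveGraph N y).Walk σ τ, elev E p

/-- The maximal elevation barrier
`m = max_{σ, τ} (H(σ, τ) - ∑_a E(σ^a) - ∑_a E(τ^a))`. -/
def barrier (E : Spin N → ℝ) (y : ℕ) : ℝ :=
  (Finset.univ : Finset (Config N y × Config N y)).sup' Finset.univ_nonempty
    fun p => height E p.1 p.2 - totalEnergy E p.1 - totalEnergy E p.2

/-- The smallest nonzero value `B` of the energy (by convention `0` if `E` vanishes identically,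
in which case `Q̄_β` does not depend on `β`). -/
def energyGap (E : Spin N → ℝ) : ℝ := sInf {b | ∃ σ, E σ ≠ 0 ∧ E σ = b}

/-- The set `𝒩₀` of replica configurations with summed energy zero. -/
def zeroSet (E : Spin N → ℝ) (y : ℕ) : Set (Config N y) := {σ | totalEnergy E σ = 0}

/-- `κ` bounds the increments of the stationary measures along the cooling schedule:
`‖Q̄_{β_n} - Q̄_{β_{n+1}}‖_∞ ≤ κ exp(-β_n B)` for all `n ≥ 1`. -/
def IncrementBound (E : Spin N → ℝ) (y : ℕ) (γ : ℝ) (β : ℕ → ℝ) (κ : ℝ) : Prop :=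
  ∀ n, 1 ≤ n → ‖(Qbar E γ (β n) : Config N y → ℝ) - Qbar E γ (β (n + 1))‖
    ≤ κ * Real.exp (-β n * energyGap E)

end ReplicatedAnnealing

end

/-! The law of the chain forgets its start, while the invariant measures drift by a summable amount.
Summability is soft: for nonnegative energies the partition function decreases in `β`, so the
increments of `Qbar` are dominated by a telescoping sum (`summable_Qbar_increments`).
`tendsto_of_forgets` then reduces the claim to weak ergodicity in ℓ¹.

If the bracket tends to `-∞`, its summands cannot eventually all be below `log κ₁`; hence infinitely
many stages satisfy `T n ≥ δ exp (β n * m)` with `δ = log κ₁ > 0`. What has to be shown is that such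
stages suffice for weak ergodicity, however small `δ` is (`exists_forgets`).

The main case is `β n → ∞` with `m > 0`. A path of elevation at most `U(w) + m` from `w` to a ground
state `h` bounds the effective resistance, and the Green function turns this into a mean hitting
time of order `exp (β m)` (`exists_survival_le`). By reversibility, together with a holding
probability at `h`, return probabilities at `h` stay bounded below. So the column `h` of the
transition matrix is charged uniformly after a large multiple of `exp (β m)` steps. To come down to
the multiple `δ`, look at the matrix of a shorter block of time: if a bounded power of it charges
`h`, then `h` is accessible through entries of uniform size, and on a finite set the number of links
needed is bounded independently of the block (`exists_contracts_pow`). Doeblin's criterion gives a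
uniform contraction.

If `β n * U` stays bounded, or if `m ≤ 0`, entries along a fixed relation leading to one
configuration are bounded below at every step, and contraction accumulates across stages. -/

noncomputable section

namespace ReplicatedAnnealing

/-! ### Contraction coefficients and Doeblin's criterion -/

section Contraction

open Matrix

variable {α : Type*} [Fintype α] [DecidableEq α]

/-- `M` contracts the `ℓ¹` norm of row vectors of total mass zero by the factor `r`. -/
def Contracts (M : Matrix α α ℝ) (r : ℝ) : Prop :=
  ∀ v : α → ℝ, ∑ x, v x = 0 → ∑ y, |(v ᵥ* M) y| ≤ r * ∑ x, |v x|

lemma sum_vecMul_of_stochastic {M : Matrix α α ℝ} (hM : M ∈ rowStochastic ℝ α) (v : α → ℝ) :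
    ∑ y, (v ᵥ* M) y = ∑ x, v x := by
  simp only [vecMul, dotProduct]
  rw [Finset.sum_comm]
  refine Finset.sum_congr rfl fun x _ => ?_
  rw [← Finset.mul_sum, sum_row_of_mem_rowStochastic hM, mul_one]

omit [DecidableEq α] in
/-- A nonnegative matrix whose rows have sum `r` scales the `ℓ¹` norm by at most `r`. -/
lemma sum_abs_vecMul_le {M : Matrix α α ℝ} {r : ℝ} (h0 : ∀ x y, 0 ≤ M x y)
    (h1 : ∀ x, ∑ y, M x y = r) (v : α → ℝ) :
    ∑ y, |(v ᵥ* M) y| ≤ r * ∑ x, |v x| := by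
  calc ∑ y, |(v ᵥ* M) y| ≤ ∑ y, ∑ x, |v x| * M x y := by
        refine Finset.sum_le_sum fun y _ => ?_
        simp only [vecMul, dotProduct]
        refine (Finset.abs_sum_le_sum_abs _ _).trans (Finset.sum_le_sum fun x _ => ?_)
        rw [abs_mul, abs_of_nonneg (h0 x y)]
    _ = r * ∑ x, |v x| := by
        rw [Finset.sum_comm, Finset.mul_sum]
        refine Finset.sum_congr rfl fun x _ => ?_
        rw [← Finset.mul_sum, h1, mul_comm]

lemma contracts_one {M : Matrix α α ℝ} (hM : M ∈ rowStochastic ℝ α) : Contracts M 1 :=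
  fun v _ => sum_abs_vecMul_le hM.1 (sum_row_of_mem_rowStochastic hM) v

/-- Doeblin's criterion: a stochastic matrix with a column bounded below by `η` is a contraction. -/
lemma contracts_of_column {M : Matrix α α ℝ} (hM : M ∈ rowStochastic ℝ α) {η : ℝ} {h : α}
    (hη : ∀ x, η ≤ M x h) : Contracts M (1 - η) := by
  intro v hv
  -- A column of constant entries annihilates vectors of mass zero, so removing `η` from column `h`
  -- changes nothing on them and lowers every row sum to `1 - η`.
  set M' : Matrix α α ℝ := fun x y => M x y - if y = h then η else 0 with hM'
  have e : v ᵥ* M = v ᵥ* M' := by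
    ext y
    simp only [vecMul, dotProduct, hM', mul_sub, Finset.sum_sub_distrib, ← Finset.sum_mul, hv]
    simp
  rw [e]
  refine sum_abs_vecMul_le (fun x y => ?_) (fun x => ?_) v
  · by_cases hy : y = h
    · subst hy; simpa [hM'] using hη x
    · simpa [hM', hy] using hM.1 x y
  · simp [hM', Finset.sum_sub_distrib, sum_row_of_mem_rowStochastic hM]

lemma Contracts.mul {M M' : Matrix α α ℝ} {r r' : ℝ} (hM : M ∈ rowStochastic ℝ α)
    (h : Contracts M r) (h' : Contracts M' r') (hr' : 0 ≤ r') : Contracts (M * M') (r * r') := by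
  intro v hv
  rw [← vecMul_vecMul]
  calc _ ≤ r' * ∑ x, |(v ᵥ* M) x| := h' _ ((sum_vecMul_of_stochastic hM v).trans hv)
    _ ≤ r' * (r * ∑ x, |v x|) := mul_le_mul_of_nonneg_left (h v hv) hr'
    _ = _ := by ring

omit [DecidableEq α] in
lemma Contracts.mono {M : Matrix α α ℝ} {r r' : ℝ} (h : Contracts M r) (hr : r ≤ r') :
    Contracts M r' := fun v hv =>
  (h v hv).trans (mul_le_mul_of_nonneg_right hr (Finset.sum_nonneg fun _ _ => abs_nonneg _))

/-- `x` is connected to `h` by a chain of exactly `n` steps of the relation `R`. -/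
def ReachesIn (R : α → α → Prop) (h : α) : ℕ → α → Prop
  | 0, x => x = h
  | n + 1, x => ∃ y, R x y ∧ ReachesIn R h n y

-- Waiting at the target pads a chain to any greater length, so exact lengths can be made uniform.
omit [Fintype α] [DecidableEq α] in
lemma ReachesIn.succ {R : α → α → Prop} {h : α} (hh : R h h) :
    ∀ {n : ℕ} {x : α}, ReachesIn R h n x → ReachesIn R h (n + 1) x
  | 0, _, hx => ⟨h, by rw [show _ = h from hx]; exact hh, rfl⟩
  | _ + 1, _, ⟨y, hxy, hy⟩ => ⟨y, hxy, hy.succ hh⟩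

omit [Fintype α] [DecidableEq α] in
lemma ReachesIn.mono {R : α → α → Prop} {h : α} (hh : R h h) {n k : ℕ} (hnk : n ≤ k) {x : α}
    (hx : ReachesIn R h n x) : ReachesIn R h k x := by
  induction hnk with
  | refl => exact hx
  | step _ ih => exact ih.succ hh

omit [Fintype α] [DecidableEq α] in
lemma exists_reachesIn {R : α → α → Prop} {h x : α} (hx : Relation.ReflTransGen R x h) :
    ∃ n, ReachesIn R h n x := by
  induction hx using Relation.ReflTransGen.head_induction_on with
  | refl => exact ⟨0, rfl⟩
  | head h1 _ ih => exact ⟨ih.choose + 1, _, h1, ih.choose_spec⟩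

lemma exists_uniform_nat {ι : Type*} [Finite ι] {p : ι → ℕ → Prop}
    (hmono : ∀ i n k, n ≤ k → p i n → p i k) (h : ∀ i, ∃ n, p i n) : ∃ n, ∀ i, p i n := by
  choose f hf using h
  obtain ⟨n, hn⟩ := (Set.finite_range f).bddAbove
  exact ⟨n, fun i => hmono i _ _ (hn ⟨i, rfl⟩) (hf i)⟩

variable (α) in
omit [DecidableEq α] in
/-- One chain length serves all relations on a finite type with a reflexive target. -/
lemma exists_uniform_reachesIn : ∃ L : ℕ, ∀ (R : α → α → Prop) (h : α), R h h →
    (∀ x, Relation.ReflTransGen R x h) → ∀ x, ReachesIn R h L x := by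
  -- There are only finitely many relations on a finite type, so a maximum over all of them exists;
  -- the resulting length does not depend on any matrix or temperature.
  obtain ⟨L, hL⟩ := exists_uniform_nat (ι := (α → α → Prop) × α × α)
    (p := fun i n => i.1 i.2.1 i.2.1 → Relation.ReflTransGen i.1 i.2.2 i.2.1 →
      ReachesIn i.1 i.2.1 n i.2.2)
    (fun i n k hnk hp h1 h2 => (hp h1 h2).mono h1 hnk)
    (fun i => by
      by_cases h2 : Relation.ReflTransGen i.1 i.2.2 i.2.1
      · obtain ⟨n, hn⟩ := exists_reachesIn h2
        exact ⟨n, fun _ _ => hn⟩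
      · exact ⟨0, fun _ h => absurd h h2⟩)
  exact ⟨L, fun R h hh hR x => hL (R, h, x) hh (hR x)⟩

/-- A stochastic matrix all of whose entries along `R` are at least `ε`. -/
def BoundedBelow (R : α → α → Prop) (ε : ℝ) (M : Matrix α α ℝ) : Prop :=
  M ∈ rowStochastic ℝ α ∧ ∀ x y, R x y → ε ≤ M x y

lemma list_prod_stochastic {l : List (Matrix α α ℝ)} (hl : ∀ M ∈ l, M ∈ rowStochastic ℝ α) :
    l.prod ∈ rowStochastic ℝ α := list_prod_mem hl

/-- A single trajectory along the chain already has this probability; the factors may differ, since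
only `R` and `ε` are common to them. -/
lemma pow_le_list_prod {R : α → α → Prop} {ε : ℝ} (hε : 0 ≤ ε) {h : α} :
    ∀ {l : List (Matrix α α ℝ)} {x : α}, (∀ M ∈ l, BoundedBelow R ε M) →
      ReachesIn R h l.length x → ε ^ l.length ≤ l.prod x h
  | [], x, _, hx => by
      rw [show x = h from hx]; simp
  | M :: l, x, hl, hx => by
      obtain ⟨y, hxy, hy⟩ := hx
      have hM := hl M (by simp)
      have hl' : ∀ M ∈ l, BoundedBelow R ε M := fun M' h' => hl M' (by simp [h'])
      have ih := pow_le_list_prod hε hl' hy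
      have hst := list_prod_stochastic fun M' h' => (hl' M' h').1
      rw [List.prod_cons, Matrix.mul_apply, List.length_cons, pow_succ']
      calc ε * ε ^ l.length ≤ M x y * l.prod y h :=
            mul_le_mul (hM.2 x y hxy) ih (by positivity) (hM.1.1 x y)
        _ ≤ _ := Finset.single_le_sum (f := fun z => M x z * l.prod z h)
            (fun z _ => mul_nonneg (hM.1.1 x z) (hst.1 z h)) (Finset.mem_univ y)

/-- Cut the product into blocks of `L` factors. Each full block has its column `h` bounded below by
`ε ^ L`, and the remainder does not expand. -/
lemma contracts_list_prod {R : α → α → Prop} {ε : ℝ} (hε : 0 ≤ ε) (hε1 : ε ≤ 1) {h : α} {L : ℕ}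
    (hL : ∀ x, ReachesIn R h L x) (l : List (Matrix α α ℝ)) (hl : ∀ M ∈ l, BoundedBelow R ε M) :
    Contracts l.prod ((1 - ε ^ L) ^ (l.length / L)) := by
  induction hn : l.length using Nat.strong_induction_on generalizing l with
  | _ n ih =>
    subst hn
    have hst := list_prod_stochastic fun M h' => (hl M h').1
    by_cases hlt : l.length < L ∨ L = 0
    · have : l.length / L = 0 := by
        rcases hlt with h1 | h1
        · exact Nat.div_eq_of_lt h1
        · simp [h1]
      rw [this, pow_zero]
      exact contracts_one hst
    · push Not at hlt
      have hpos : 0 < L := Nat.pos_of_ne_zero hlt.2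
      have h1 : ∀ M ∈ l.take L, BoundedBelow R ε M := fun M h' => hl M (List.mem_of_mem_take h')
      have h2 : ∀ M ∈ l.drop L, BoundedBelow R ε M := fun M h' => hl M (List.mem_of_mem_drop h')
      have hlen : (l.take L).length = L := by simp [hlt.1]
      have hlen' : (l.drop L).length = l.length - L := by simp
      have st1 := list_prod_stochastic fun M h' => (h1 M h').1
      have c1 : Contracts (l.take L).prod (1 - ε ^ L) := contracts_of_column (h := h) st1 fun x => by
        have := pow_le_list_prod hε h1 (x := x) (h := h) (by rw [hlen]; exact hL x)
        rwa [hlen] at this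
      have c2 := ih _ (by rw [hlen']; omega) (l.drop L) h2 rfl
      have hq : l.length / L = (l.drop L).length / L + 1 := by
        rw [hlen', Nat.div_eq_sub_div hpos hlt.1]
      rw [← List.take_append_drop L l, List.prod_append, List.take_append_drop, hq, pow_succ']
      exact c1.mul st1 c2 (pow_nonneg (sub_nonneg.2 (pow_le_one₀ hε hε1)) _)

/-! ### Weak and strong ergodicity of inhomogeneous chains -/

/-- The transition matrix from time `k` to time `k + j` of an inhomogeneous chain. -/
def transition (M : ℕ → Matrix α α ℝ) (k : ℕ) : ℕ → Matrix α α ℝ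
  | 0 => 1
  | j + 1 => transition M k j * M (k + j + 1)

lemma transition_stochastic {M : ℕ → Matrix α α ℝ} {k : ℕ}
    (hM : ∀ n, k ≤ n → M n ∈ rowStochastic ℝ α) (j : ℕ) :
    transition M k j ∈ rowStochastic ℝ α := by
  induction j with
  | zero => exact one_mem _
  | succ j ih => exact mul_mem ih (hM _ (by omega))

/-- Weak ergodicity after time `k`. -/
def Forgets (M : ℕ → Matrix α α ℝ) (k : ℕ) : Prop :=
  ∀ ε : ℝ, 0 < ε → ∀ᶠ j in atTop, Contracts (transition M k j) ε

/-- Infinitely many uniformly contracting factors give weak ergodicity. -/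
lemma forgets_of_frequently {M : ℕ → Matrix α α ℝ} {k : ℕ}
    (hM : ∀ n, k ≤ n → M n ∈ rowStochastic ℝ α) {r : ℝ} (hr0 : 0 ≤ r) (hr1 : r < 1)
    (h : ∃ᶠ n in atTop, Contracts (M n) r) : Forgets M k := by
  have key : ∀ i : ℕ, ∀ᶠ j in atTop, Contracts (transition M k j) (r ^ i) := by
    have step : ∀ {s : ℝ} {j : ℕ}, Contracts (transition M k j) s →
        ∀ j', j ≤ j' → Contracts (transition M k j') s := by
      intro s j hs j' hj
      induction hj with
      | refl => exact hs
      | @step i _ ih =>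
        have := ih.mul (transition_stochastic hM i) (contracts_one (hM (k + i + 1) (by omega)))
          zero_le_one
        rwa [mul_one] at this
    intro i
    induction i with
    | zero =>
      exact Eventually.of_forall fun j => by
        rw [pow_zero]; exact contracts_one (transition_stochastic hM j)
    | succ i ih =>
      obtain ⟨j₀, hj₀⟩ := eventually_atTop.1 ih
      obtain ⟨n, hn, hc⟩ := frequently_atTop.1 h (k + j₀ + 1)
      obtain ⟨j, rfl⟩ : ∃ j, n = k + j + 1 := ⟨n - k - 1, by omega⟩
      refine eventually_atTop.2 ⟨j + 1, step ?_⟩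
      rw [pow_succ]
      exact (hj₀ j (by omega)).mul (transition_stochastic hM j) hc hr0
  intro ε hε
  obtain ⟨i, hi⟩ := exists_pow_lt_of_lt_one hε hr1
  filter_upwards [key i] with j hj using hj.mono hi.le

/-- A chain making infinitely many steps, all with entries bounded below along a fixed relation,
is weakly ergodic. -/
lemma forgets_of_boundedBelow {S : ℕ → Matrix α α ℝ} {T : ℕ → ℕ} {k : ℕ}
    {R : α → α → Prop} {ε : ℝ} (hε : 0 < ε) (hε1 : ε ≤ 1) {h : α} (hh : R h h)
    (hR : ∀ x, Relation.ReflTransGen R x h)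
    (hS : ∀ n, k ≤ n → BoundedBelow R ε (S n)) (hT : ∃ᶠ n in atTop, 1 ≤ T n) :
    Forgets (fun n => S n ^ T n) k := by
  obtain ⟨L, hL⟩ := exists_uniform_reachesIn α
  -- The block length must be positive, for otherwise the number of blocks would be `0` by the
  -- convention for division by zero.
  replace hL : ∀ x, ReachesIn R h (L + 1) x := fun x => (hL R h hh hR x).succ hh
  have hlist : ∀ j, ∃ l : List (Matrix α α ℝ), (∀ M ∈ l, BoundedBelow R ε M) ∧
      l.length = ∑ i ∈ Finset.range j, T (k + i + 1) ∧
      transition (fun n => S n ^ T n) k j = l.prod := by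
    intro j
    induction j with
    | zero => exact ⟨[], by simp, by simp, rfl⟩
    | succ j ih =>
      obtain ⟨l, h1, h2, h3⟩ := ih
      refine ⟨l ++ List.replicate (T (k + j + 1)) (S (k + j + 1)), ?_, ?_, ?_⟩
      · intro M hM
        rcases List.mem_append.1 hM with h' | h'
        · exact h1 M h'
        · rw [List.eq_of_mem_replicate h']
          exact hS _ (by omega)
      · simp [h2, Finset.sum_range_succ]
      · simp [transition, h3]
  have hsum : Tendsto (fun j => ∑ i ∈ Finset.range j, T (k + i + 1)) atTop atTop := by
    refine tendsto_atTop_atTop_of_monotone (fun a b hab => Finset.sum_le_sum_of_subset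
      (Finset.range_mono hab)) fun b => ?_
    induction b with
    | zero => exact ⟨0, by simp⟩
    | succ b ih =>
      obtain ⟨j₀, hj₀⟩ := ih
      obtain ⟨n, hn, hc⟩ := frequently_atTop.1 hT (k + j₀ + 1)
      obtain ⟨j, rfl⟩ : ∃ j, n = k + j + 1 := ⟨n - k - 1, by omega⟩
      refine ⟨j + 1, ?_⟩
      rw [Finset.sum_range_succ]
      exact Nat.add_le_add (hj₀.trans (Finset.sum_le_sum_of_subset
        (Finset.range_mono (by omega)))) hc
  intro δ hδ
  have hη1 : 1 - ε ^ (L + 1) < 1 := by have := pow_pos hε (L + 1); linarith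
  have hη0 : 0 ≤ 1 - ε ^ (L + 1) := sub_nonneg.2 (pow_le_one₀ hε.le hε1)
  obtain ⟨i, hi⟩ := exists_pow_lt_of_lt_one hδ hη1
  filter_upwards [hsum.eventually_ge_atTop (i * (L + 1))] with j hj
  obtain ⟨l, h1, h2, h3⟩ := hlist j
  rw [h3]
  refine (contracts_list_prod hε.le hε1 hL l h1).mono
    ((pow_le_pow_of_le_one hη0 hη1.le ?_).trans hi.le)
  rw [h2]
  exact (Nat.le_div_iff_mul_le (Nat.succ_pos L)).2 hj

/-- Strong ergodicity from weak ergodicity and summable increments of the invariant measures. -/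
lemma tendsto_of_forgets {M : ℕ → Matrix α α ℝ} {ν Q : ℕ → α → ℝ} {k₀ : ℕ}
    (hM : ∀ n, k₀ ≤ n → M n ∈ rowStochastic ℝ α)
    (hν : ∀ n, ν (n + 1) = ν n ᵥ* M (n + 1)) (hQ : ∀ n, k₀ ≤ n → Q n ᵥ* M n = Q n)
    (hmass : ∀ n, ∑ x, ν n x = ∑ x, Q n x)
    (hsum : Summable fun n => ∑ x, |Q n x - Q (n + 1) x|)
    (hF : ∀ k, k₀ ≤ k → Forgets M k) :
    Tendsto (fun n => ∑ x, |Q n x - ν n x|) atTop (𝓝 0) := by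
  set a : ℕ → ℝ := fun n => ∑ x, |Q n x - Q (n + 1) x| with ha
  have ha0 : ∀ n, 0 ≤ a n := fun n => Finset.sum_nonneg fun _ _ => abs_nonneg _
  have key : ∀ k, k₀ ≤ k → ∀ j, ∑ x, |((Q (k + j) - ν (k + j)) -
      (Q k - ν k) ᵥ* transition M k j) x| ≤ ∑ i ∈ Finset.range j, a (k + i) := by
    intro k hk j
    induction j with
    | zero => simp [transition]
    | succ j ih =>
      have hst := hM (k + j + 1) (by omega)
      -- Since `Q (k + j + 1)` is invariant under the next matrix, the discrepancy evolves by adding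
      -- one increment and applying a stochastic matrix, which does not expand ℓ¹.
      have e : (Q (k + (j + 1)) - ν (k + (j + 1))) - (Q k - ν k) ᵥ* transition M k (j + 1) =
          (((Q (k + j) - ν (k + j)) - (Q k - ν k) ᵥ* transition M k j) +
            (Q (k + j + 1) - Q (k + j))) ᵥ* M (k + j + 1) := by
        rw [transition, ← vecMul_vecMul, ← add_assoc, hν, ← hQ (k + j + 1) (by omega)]
        simp only [sub_vecMul, add_vecMul]
        rw [hQ (k + j + 1) (by omega), hQ (k + j + 1) (by omega)]
        abel
      rw [e, Finset.sum_range_succ]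
      refine (sum_abs_vecMul_le hst.1 (sum_row_of_mem_rowStochastic hst) _).trans ?_
      rw [one_mul]
      refine (Finset.sum_le_sum fun x _ => abs_add_le _ _).trans ?_
      rw [Finset.sum_add_distrib]
      refine add_le_add ih (le_of_eq (Finset.sum_congr rfl fun x _ => ?_))
      rw [abs_sub_comm]; rfl
  rw [Metric.tendsto_atTop]
  intro ε hε
  have htail := tendsto_sum_nat_add a
  obtain ⟨k, hk1, hk⟩ : ∃ k, ∑' i, a (i + k) < ε / 2 ∧ k₀ ≤ k :=
    ((htail.eventually_lt_const (half_pos hε)).and (eventually_ge_atTop k₀)).exists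
  set D := ∑ x, |(Q k - ν k) x|
  have hD : 0 ≤ D := Finset.sum_nonneg fun _ _ => abs_nonneg _
  obtain ⟨j₀, hj₀⟩ := eventually_atTop.1 (hF k hk (ε / 2 / (D + 1)) (by positivity))
  refine ⟨k + j₀, fun n hn => ?_⟩
  obtain ⟨j, rfl⟩ : ∃ j, n = k + j := ⟨n - k, by omega⟩
  have h1 := hj₀ j (by omega) (Q k - ν k) (by
    simp only [Pi.sub_apply, Finset.sum_sub_distrib, hmass k, sub_self])
  have h2 : ε / 2 / (D + 1) * D ≤ ε / 2 := by
    rw [div_mul_eq_mul_div, div_le_iff₀ (by positivity)]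
    nlinarith
  have h3 : ∑ i ∈ Finset.range j, a (k + i) ≤ ∑' i, a (i + k) := by
    simp_rw [add_comm k]
    exact ((summable_nat_add_iff k).2 hsum).sum_le_tsum _ fun i _ => ha0 _
  have h4 : ∑ x, |Q (k + j) x - ν (k + j) x| ≤
      ∑ x, |((Q (k + j) - ν (k + j)) - (Q k - ν k) ᵥ* transition M k j) x| +
      ∑ x, |((Q k - ν k) ᵥ* transition M k j) x| := by
    rw [← Finset.sum_add_distrib]
    refine Finset.sum_le_sum fun x _ => ?_
    refine le_trans (le_of_eq ?_) (abs_add_le _ _)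
    simp
  have h5 := key k hk j
  rw [Real.dist_0_eq_abs, abs_of_nonneg (Finset.sum_nonneg fun _ _ => abs_nonneg _)]
  linarith

end Contraction

/-! ### Green functions, hitting times and return probabilities of reversible chains -/

section Hitting

open Matrix

variable {α : Type*} [Fintype α] [DecidableEq α]

/-- One step of the chain `S` killed at `h`, acting on functions. -/
def killedStep (S : Matrix α α ℝ) (h : α) (g : α → ℝ) (x : α) : ℝ :=
  if x = h then 0 else ∑ y, S x y * g y

/-- The expected number of visits to `w` before time `n` and before hitting `h`. -/
def green (S : Matrix α α ℝ) (h w : α) : ℕ → α → ℝ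
  | 0 => 0
  | n + 1 => fun x => (if x = w then 1 else 0) + killedStep S h (green S h w n) x

/-- The probability not to have hit `h` up to time `n`. -/
def survival (S : Matrix α α ℝ) (h : α) : ℕ → α → ℝ
  | 0 => fun x => if x = h then 0 else 1
  | n + 1 => killedStep S h (survival S h n)

/-- The Dirichlet form of `S` with respect to the weights `q`. -/
def dirichlet (q : α → ℝ) (S : Matrix α α ℝ) (g : α → ℝ) : ℝ :=
  1 / 2 * ∑ x, ∑ y, q x * S x y * (g x - g y) ^ 2

variable {S : Matrix α α ℝ} {h w : α}

lemma killedStep_mono (hS : S ∈ rowStochastic ℝ α) {f g : α → ℝ} (hfg : ∀ x, f x ≤ g x) (x : α) :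
    killedStep S h f x ≤ killedStep S h g x := by
  unfold killedStep
  split_ifs
  · exact le_rfl
  · exact Finset.sum_le_sum fun y _ => mul_le_mul_of_nonneg_left (hfg y) (hS.1 x y)

lemma killedStep_nonneg (hS : S ∈ rowStochastic ℝ α) {g : α → ℝ} (hg : ∀ x, 0 ≤ g x) (x : α) :
    0 ≤ killedStep S h g x := by
  unfold killedStep
  split_ifs
  · exact le_rfl
  · exact Finset.sum_nonneg fun y _ => mul_nonneg (hS.1 x y) (hg y)

lemma killedStep_le (hS : S ∈ rowStochastic ℝ α) {g : α → ℝ} {c : ℝ} (hc : 0 ≤ c)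
    (hg : ∀ x, g x ≤ c) (x : α) : killedStep S h g x ≤ c := by
  unfold killedStep
  split_ifs
  · exact hc
  · calc ∑ y, S x y * g y ≤ ∑ y, S x y * c :=
          Finset.sum_le_sum fun y _ => mul_le_mul_of_nonneg_left (hg y) (hS.1 x y)
      _ = c := by rw [← Finset.sum_mul, sum_row_of_mem_rowStochastic hS, one_mul]

lemma killedStep_sum {ι : Type*} (s : Finset ι) (f : ι → α → ℝ) (x : α) :
    killedStep S h (fun y => ∑ i ∈ s, f i y) x = ∑ i ∈ s, killedStep S h (f i) x := by
  unfold killedStep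
  split_ifs
  · simp
  · simp_rw [Finset.mul_sum]
    exact Finset.sum_comm

lemma green_nonneg (hS : S ∈ rowStochastic ℝ α) (n : ℕ) (x : α) : 0 ≤ green S h w n x := by
  induction n generalizing x with
  | zero => exact le_rfl
  | succ n ih =>
    refine add_nonneg ?_ (killedStep_nonneg hS ih x)
    split_ifs <;> norm_num

lemma green_le_succ (hS : S ∈ rowStochastic ℝ α) (n : ℕ) (x : α) :
    green S h w n x ≤ green S h w (n + 1) x := by
  induction n generalizing x with
  | zero => exact green_nonneg hS 1 x
  | succ n ih => exact add_le_add le_rfl (killedStep_mono hS ih x)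

lemma green_target (hw : w ≠ h) (n : ℕ) : green S h w n h = 0 := by
  cases n with
  | zero => rfl
  | succ n => simp [green, killedStep, hw.symm]

/-- The maximum principle: the Green function is largest at its pole. -/
lemma green_le_pole (hS : S ∈ rowStochastic ℝ α) (n : ℕ) (x : α) :
    green S h w n x ≤ green S h w n w := by
  induction n generalizing x with
  | zero => exact le_rfl
  | succ n ih =>
    by_cases hx : x = w
    · rw [hx]
    · calc green S h w (n + 1) x = killedStep S h (green S h w n) x := by simp [green, hx]
        _ ≤ green S h w n w := killedStep_le hS (green_nonneg hS n w) ih x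
        _ ≤ _ := green_le_succ hS n w

lemma dirichlet_eq {q : α → ℝ} (hS : S ∈ rowStochastic ℝ α)
    (hrev : ∀ x y, q x * S x y = q y * S y x) (g : α → ℝ) :
    dirichlet q S g = ∑ x, q x * g x * (g x - ∑ y, S x y * g y) := by
  have e1 : ∑ x, ∑ y, q x * S x y * g x ^ 2 = ∑ x, q x * g x ^ 2 := by
    refine Finset.sum_congr rfl fun x _ => ?_
    rw [← Finset.sum_mul, ← Finset.mul_sum, sum_row_of_mem_rowStochastic hS, mul_one]
  have e2 : ∑ x, ∑ y, q x * S x y * g y ^ 2 = ∑ x, q x * g x ^ 2 := by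
    rw [Finset.sum_comm, ← e1]
    simp_rw [hrev]
  have e3 : ∑ x, q x * g x * (g x - ∑ y, S x y * g y) =
      ∑ x, q x * g x ^ 2 - ∑ x, ∑ y, q x * S x y * (g x * g y) := by
    rw [← Finset.sum_sub_distrib]
    refine Finset.sum_congr rfl fun x _ => ?_
    rw [mul_sub, Finset.mul_sum]
    congr 1
    · ring
    · exact Finset.sum_congr rfl fun y _ => by ring
  have e4 : ∑ x, ∑ y, q x * S x y * (g x - g y) ^ 2 =
      ∑ x, ∑ y, q x * S x y * g x ^ 2 + ∑ x, ∑ y, q x * S x y * g y ^ 2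
        - 2 * ∑ x, ∑ y, q x * S x y * (g x * g y) := by
    simp_rw [Finset.mul_sum, ← Finset.sum_add_distrib, ← Finset.sum_sub_distrib]
    exact Finset.sum_congr rfl fun x _ => Finset.sum_congr rfl fun y _ => by ring
  rw [dirichlet, e4, e3, e1, e2]
  ring

/-- Off `h` the truncated Green function `G` satisfies `G - S G ≤ 1_{w}`, because it increases with
the time horizon; at `h` it vanishes. Summation by parts turns this into the energy bound, without
passing to infinite time. -/
lemma dirichlet_green_le {q : α → ℝ} (hq : ∀ x, 0 ≤ q x) (hS : S ∈ rowStochastic ℝ α)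
    (hrev : ∀ x y, q x * S x y = q y * S y x) (hw : w ≠ h) (n : ℕ) :
    dirichlet q S (green S h w n) ≤ q w * green S h w n w := by
  rw [dirichlet_eq hS hrev]
  have hx : ∀ x, q x * green S h w n x * (green S h w n x - ∑ y, S x y * green S h w n y) ≤
      if x = w then q w * green S h w n w else 0 := by
    intro x
    by_cases hxh : x = h
    · subst hxh
      simp [green_target hw, hw.symm]
    · have h1 : green S h w n x ≤ (if x = w then 1 else 0) + ∑ y, S x y * green S h w n y := by
        simpa [green, killedStep, hxh] using green_le_succ (h := h) (w := w) hS n x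
      have h0 := mul_nonneg (hq x) (green_nonneg (h := h) (w := w) hS n x)
      by_cases hxw : x = w
      · subst hxw
        simp only [if_true] at h1 ⊢
        nlinarith
      · simp only [hxw, if_false] at h1 ⊢
        nlinarith
  refine (Finset.sum_le_sum fun x _ => hx x).trans ?_
  simp

/-- Here `ρ` plays the role of an effective resistance between `w` and `h`: it gives `G(w)² ≤ ρ *
dirichlet q S G ≤ ρ * q w * G(w)`, and one factor `G(w)` cancels. -/
lemma green_pole_le {q : α → ℝ} (hq : ∀ x, 0 ≤ q x) (hS : S ∈ rowStochastic ℝ α)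
    (hrev : ∀ x y, q x * S x y = q y * S y x) (hw : w ≠ h) {ρ : ℝ} (hρ : 0 ≤ ρ)
    (hres : ∀ g : α → ℝ, (g w - g h) ^ 2 ≤ ρ * dirichlet q S g) (n : ℕ) :
    green S h w n w ≤ ρ * q w := by
  have h1 := hres (green S h w n)
  rw [green_target hw, sub_zero] at h1
  have h2 := h1.trans (mul_le_mul_of_nonneg_left (dirichlet_green_le hq hS hrev hw n) hρ)
  rcases (green_nonneg (h := h) (w := w) hS n w).eq_or_lt with h0 | h0
  · rw [← h0]; exact mul_nonneg hρ (hq w)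
  · nlinarith

/-- Both sides compute the mean time spent away from `h` before hitting it, truncated at `n`: one by
place, the other by time. -/
lemma sum_green (n : ℕ) (x : α) :
    ∑ w ∈ Finset.univ.erase h, green S h w n x = ∑ t ∈ Finset.range n, survival S h t x := by
  induction n generalizing x with
  | zero => simp [green]
  | succ n ih =>
    rw [Finset.sum_range_succ']
    simp only [green, survival, Finset.sum_add_distrib]
    rw [← killedStep_sum, ← killedStep_sum, add_comm]
    simp_rw [ih]
    congr 1
    by_cases hx : x = h <;> simp [hx]

lemma survival_target (n : ℕ) : survival S h n h = 0 := by
  cases n <;> simp [survival, killedStep]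

lemma survival_antitone (hS : S ∈ rowStochastic ℝ α) (x : α) :
    Antitone fun n => survival S h n x := by
  refine antitone_nat_of_succ_le fun n => ?_
  induction n generalizing x with
  | zero =>
    simp only [survival]
    by_cases hx : x = h
    · simp [killedStep, hx]
    · rw [if_neg hx]
      exact killedStep_le hS zero_le_one (fun y => by split_ifs <;> norm_num) x
  | succ n ih => exact killedStep_mono hS ih x

/-- Markov's inequality for the hitting time of `h`, whose mean is bounded by the sum of the
Green function over its poles. -/
lemma survival_le {q ρ : α → ℝ} (hq : ∀ x, 0 ≤ q x) (hS : S ∈ rowStochastic ℝ α)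
    (hrev : ∀ x y, q x * S x y = q y * S y x) (hρ : ∀ w, 0 ≤ ρ w)
    (hres : ∀ (w : α) (g : α → ℝ), (g w - g h) ^ 2 ≤ ρ w * dirichlet q S g) (n : ℕ) (x : α) :
    n * survival S h n x ≤ ∑ w, ρ w * q w := by
  calc (n : ℝ) * survival S h n x = ∑ _t ∈ Finset.range n, survival S h n x := by simp
    _ ≤ ∑ t ∈ Finset.range n, survival S h t x :=
        Finset.sum_le_sum fun t ht => survival_antitone hS x (Finset.mem_range.1 ht).le
    _ = ∑ w ∈ Finset.univ.erase h, green S h w n x := (sum_green n x).symm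
    _ ≤ ∑ w ∈ Finset.univ.erase h, ρ w * q w := Finset.sum_le_sum fun w hw =>
        (green_le_pole hS n x).trans
          (green_pole_le hq hS hrev (Finset.ne_of_mem_erase hw) (hρ w) (hres w) n)
    _ ≤ ∑ w, ρ w * q w := Finset.sum_le_sum_of_subset_of_nonneg (Finset.subset_univ _)
        fun w _ _ => mul_nonneg (hρ w) (hq w)

/-- Strong Markov property at the hitting time of `h`: the return bound holds for every remaining
time. The induction conditions on the first step. -/
lemma le_pow_apply_target (hS : S ∈ rowStochastic ℝ α) {c : ℝ}
    (hc : ∀ n, c ≤ (S ^ n) h h) (n : ℕ) (x : α) :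
    c * (1 - survival S h n x) ≤ (S ^ n) x h := by
  induction n generalizing x with
  | zero =>
    by_cases hx : x = h
    · subst hx; simpa [survival] using hc 0
    · simp [survival, hx]
  | succ n ih =>
    by_cases hx : x = h
    · subst hx; rw [survival_target]; simpa using hc (n + 1)
    · rw [pow_succ', Matrix.mul_apply]
      calc c * (1 - survival S h (n + 1) x) = ∑ y, S x y * (c * (1 - survival S h n y)) := by
            have : survival S h (n + 1) x = ∑ y, S x y * survival S h n y := by
              simp [survival, killedStep, hx]
            rw [this]
            calc c * (1 - ∑ y, S x y * survival S h n y)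
                = c * (∑ y, S x y - ∑ y, S x y * survival S h n y) := by
                  rw [sum_row_of_mem_rowStochastic hS]
              _ = _ := by
                  rw [← Finset.sum_sub_distrib, Finset.mul_sum]
                  exact Finset.sum_congr rfl fun y _ => by ring
        _ ≤ _ := Finset.sum_le_sum fun y _ => mul_le_mul_of_nonneg_left (ih y) (hS.1 x y)

lemma reversible_pow {q : α → ℝ} (hrev : ∀ x y, q x * S x y = q y * S y x) (n : ℕ) (x y : α) :
    q x * (S ^ n) x y = q y * (S ^ n) y x := by
  induction n generalizing x y with
  | zero =>
    by_cases hxy : x = y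
    · rw [hxy]
    · simp [hxy, Ne.symm hxy]
  | succ n ih =>
    rw [pow_succ, Matrix.mul_apply, ← pow_succ, pow_succ', Matrix.mul_apply, Finset.mul_sum,
      Finset.mul_sum]
    refine Finset.sum_congr rfl fun z _ => ?_
    rw [← mul_assoc, ih, mul_right_comm, hrev]
    ring

/-- Return probabilities of a reversible chain at even times dominate the invariant measure. -/
lemma div_sum_le_pow_even {q : α → ℝ} (hq : ∀ x, 0 < q x) (hS : S ∈ rowStochastic ℝ α)
    (hrev : ∀ x y, q x * S x y = q y * S y x) (n : ℕ) (x : α) :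
    q x / ∑ y, q y ≤ (S ^ (2 * n)) x x := by
  have hst : S ^ n ∈ rowStochastic ℝ α := pow_mem hS n
  have hsum : 0 < ∑ y, q y := Finset.sum_pos (fun y _ => hq y) ⟨x, Finset.mem_univ x⟩
  -- Reversibility makes the return probability a weighted sum of squares, to which Cauchy–Schwarz
  -- applies.
  have e : (S ^ (2 * n)) x x = q x * ∑ y, (S ^ n) x y ^ 2 / q y := by
    rw [two_mul, pow_add, Matrix.mul_apply, Finset.mul_sum]
    refine Finset.sum_congr rfl fun y _ => ?_
    have := reversible_pow hrev n x y
    have hy := (hq y).ne'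
    field_simp
    linear_combination (-(S ^ n) x y) * this
  have cs := Finset.sq_sum_div_le_sum_sq_div Finset.univ (fun y => (S ^ n) x y) fun y _ => hq y
  rw [e, div_eq_mul_inv]
  refine mul_le_mul_of_nonneg_left ?_ (hq x).le
  rwa [sum_row_of_mem_rowStochastic hst, one_pow, one_div] at cs

/-- If `A ^ k` charges the column `h` then `h` can be reached through large entries of `A`. -/
lemma reflTransGen_of_le_pow {A : Matrix α α ℝ} (hA : A ∈ rowStochastic ℝ α) {c ε : ℝ} {k : ℕ}
    (hε : 0 ≤ ε) (hk : ∀ x, c ≤ (A ^ k) x h) (hc : k * (Fintype.card α * ε) < c) (x : α) :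
    Relation.ReflTransGen (fun y z => ε ≤ A y z) x h := by
  classical
  -- From outside `s` every entry into `s` is smaller than `ε`, so the probability of being in `s`
  -- after `n` steps is at most `n * card α * ε`. For `n = k` this is too small to charge `h ∈ s`.
  set s : Finset α := {y | Relation.ReflTransGen (fun y z => ε ≤ A y z) y h} with hs
  have hleak : ∀ y, y ∉ s → ∑ z ∈ s, A y z ≤ Fintype.card α * ε := by
    intro y hy
    calc ∑ z ∈ s, A y z ≤ ∑ _z ∈ s, ε := by
          refine Finset.sum_le_sum fun z hz => le_of_not_ge fun hyz => hy ?_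
          rw [hs, Finset.mem_filter] at hz ⊢
          exact ⟨Finset.mem_univ _, Relation.ReflTransGen.head hyz hz.2⟩
      _ = s.card * ε := by simp
      _ ≤ _ := by gcongr; exact Finset.card_le_univ s
  have key : ∀ (n : ℕ) (y : α), y ∉ s → ∑ z ∈ s, (A ^ n) y z ≤ n * (Fintype.card α * ε) := by
    intro n
    induction n with
    | zero =>
      intro y hy
      refine le_of_eq ?_
      rw [Nat.cast_zero, zero_mul]
      refine Finset.sum_eq_zero fun z hz => ?_
      rw [pow_zero, Matrix.one_apply_ne]
      rintro rfl
      exact hy hz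
    | succ n ih =>
      intro y hy
      have hst : A ^ n ∈ rowStochastic ℝ α := pow_mem hA n
      simp_rw [pow_succ', Matrix.mul_apply]
      rw [Finset.sum_comm]
      simp_rw [← Finset.mul_sum]
      rw [← Finset.sum_add_sum_compl s]
      have h1 : ∑ z ∈ s, A y z * ∑ u ∈ s, (A ^ n) z u ≤ Fintype.card α * ε := by
        refine (Finset.sum_le_sum fun z _ => ?_).trans (hleak y hy)
        refine mul_le_of_le_one_right (hA.1 y z) ?_
        rw [← sum_row_of_mem_rowStochastic hst z]
        exact Finset.sum_le_sum_of_subset_of_nonneg (Finset.subset_univ _) fun u _ _ => hst.1 z u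
      have h2 : ∑ z ∈ sᶜ, A y z * ∑ u ∈ s, (A ^ n) z u ≤ n * (Fintype.card α * ε) := by
        calc _ ≤ ∑ z ∈ sᶜ, A y z * (n * (Fintype.card α * ε)) := Finset.sum_le_sum fun z hz =>
              mul_le_mul_of_nonneg_left (ih z (Finset.mem_compl.1 hz)) (hA.1 y z)
          _ = (∑ z ∈ sᶜ, A y z) * (n * (Fintype.card α * ε)) := by rw [Finset.sum_mul]
          _ ≤ _ := by
              refine mul_le_of_le_one_left (by positivity) ?_
              rw [← sum_row_of_mem_rowStochastic hA y]
              exact Finset.sum_le_sum_of_subset_of_nonneg (Finset.subset_univ _)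
                fun u _ _ => hA.1 y u
      push_cast
      linarith
  by_contra hx
  have hxs : x ∉ s := by simpa [hs] using hx
  have hhs : h ∈ s := by simpa [hs] using Relation.ReflTransGen.refl
  have hst : A ^ k ∈ rowStochastic ℝ α := pow_mem hA k
  have := (hk x).trans ((Finset.single_le_sum (f := fun z => (A ^ k) x z)
    (fun z _ => hst.1 x z) hhs).trans (key k x hxs))
  linarith

variable (α) in
/-- If a chain charges `h` uniformly after time `C a`, then it contracts by a uniform factor already
after time `δ a`, however small `δ`. -/
lemma exists_contracts_pow {c δ C : ℝ} (hc : 0 < c) (hc1 : c ≤ 1) (hδ : 0 < δ) :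
    ∃ (L : ℕ) (r : ℝ), 0 ≤ r ∧ r < 1 ∧ ∀ (S : Matrix α α ℝ) (h : α) (a : ℝ),
      S ∈ rowStochastic ℝ α → 0 ≤ a → (∀ n, c ≤ (S ^ n) h h) →
      (∀ (n : ℕ) (x : α), C * a ≤ n → c ≤ (S ^ n) x h) →
      ∀ n : ℕ, L ≤ n → δ * a ≤ n → Contracts (S ^ n) r := by
  obtain ⟨L', hL'⟩ := exists_uniform_reachesIn α
  set L := L' + 1 with hLdef
  have hL : ∀ (R : α → α → Prop) (h : α), R h h → (∀ x, Relation.ReflTransGen R x h) →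
      ∀ x, ReachesIn R h L x := fun R h hh hR x => (hL' R h hh hR x).succ hh
  have hL0 : (0 : ℝ) < L := by positivity
  -- With blocks of length `t = n / L`, rounding gives `n ≤ 2 * t * L`; this `K` then makes `K`
  -- blocks last at least `C * a`, while `L` blocks fit into `n`.
  obtain ⟨K, hK⟩ := exists_nat_ge (2 * L * C / δ)
  -- The second bound keeps the total leakage over `K` blocks below `c`; the first makes the
  -- relation reflexive at `h`.
  set ε : ℝ := min c (c / (2 * (K * Fintype.card α + 1))) with hεdef
  have hε : 0 < ε := lt_min hc (by positivity)
  have hεc : ε ≤ c := min_le_left _ _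
  have hε2 : K * (Fintype.card α * ε) < c := by
    have h1 : ε * (2 * (K * Fintype.card α + 1)) ≤ c :=
      (le_div_iff₀ (by positivity)).1 (min_le_right _ _)
    have h2 : (0 : ℝ) ≤ K * Fintype.card α := by positivity
    nlinarith
  refine ⟨L, 1 - ε ^ L, sub_nonneg.2 (pow_le_one₀ hε.le (hεc.trans hc1)),
    by have := pow_pos hε L; linarith, fun S h a hS ha hret hhit n hLn hn => ?_⟩
  set t := n / L with ht
  have ht1 : 1 ≤ t := (Nat.one_le_div_iff (by omega)).2 hLn
  have htn : t * L ≤ n := Nat.div_mul_le_self n L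
  have hnt : (n : ℝ) ≤ 2 * t * L := by
    have h1 : n < (t + 1) * L := by
      have := Nat.lt_mul_div_succ n (show 0 < L by omega)
      rw [mul_comm]; exact this
    have : n ≤ 2 * t * L := by nlinarith
    exact_mod_cast this
  have hA : S ^ t ∈ rowStochastic ℝ α := pow_mem hS t
  have hCa : C * a ≤ ((t * K : ℕ) : ℝ) := by
    rw [div_le_iff₀ hδ] at hK
    push_cast
    have h1 : 2 * L * (C * a) ≤ 2 * L * (t * K) := by
      calc 2 * L * (C * a) = 2 * L * C * a := by ring
        _ ≤ K * δ * a := mul_le_mul_of_nonneg_right hK ha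
        _ = K * (δ * a) := by ring
        _ ≤ K * (2 * t * L) := mul_le_mul_of_nonneg_left (hn.trans hnt) (Nat.cast_nonneg K)
        _ = _ := by ring
    exact le_of_mul_le_mul_left h1 (by positivity)
  have hreach : ∀ x, ReachesIn (fun y z => ε ≤ (S ^ t) y z) h L x := by
    refine hL _ h (hεc.trans (hret t)) (reflTransGen_of_le_pow hA hε.le (k := K) (fun x => ?_) hε2)
    rw [← pow_mul]
    exact hhit _ x hCa
  have hcol : ∀ x, ε ^ L ≤ ((S ^ t) ^ L) x h := fun x => by
    have := pow_le_list_prod (R := fun y z => ε ≤ (S ^ t) y z) (l := List.replicate L (S ^ t))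
      (x := x) (h := h) hε.le
      (fun M hM => by rw [List.eq_of_mem_replicate hM]; exact ⟨hA, fun _ _ h => h⟩)
      (by rw [List.length_replicate]; exact hreach x)
    simpa using this
  have e : S ^ n = (S ^ t) ^ L * S ^ (n - t * L) := by
    rw [← pow_mul, ← pow_add, Nat.add_sub_cancel' htn]
  rw [e]
  have := (contracts_of_column (pow_mem hA L) hcol).mul (pow_mem hA L)
    (contracts_one (pow_mem hS (n - t * L))) zero_le_one
  rwa [mul_one] at this

end Hitting

/-! ### The replicated Metropolis dynamics: reversibility and holding probabilities -/

section Metropolis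

open Matrix

variable {N y : ℕ}

lemma exists_pos_forall_le {ι : Type*} [Finite ι] {f : ι → ℝ} (hf : ∀ i, 0 < f i) :
    ∃ c : ℝ, 0 < c ∧ c ≤ 1 ∧ ∀ i, c ≤ f i := by
  rcases isEmpty_or_nonempty ι with h | h
  · exact ⟨1, one_pos, le_rfl, fun i => h.elim i⟩
  · obtain ⟨i, hi⟩ := Finite.exists_min f
    exact ⟨min 1 (f i), lt_min one_pos (hf i), min_le_left _ _,
      fun j => (min_le_right _ _).trans (hi j)⟩

lemma flip_flip (σ : Config N y) (a : Fin y) (i : Fin N) : flip (flip σ a i) a i = σ := by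
  simp [flip]

lemma flip_ne (σ : Config N y) (a : Fin y) (i : Fin N) : flip σ a i ≠ σ := by
  intro h
  have := congrFun (congrFun h a) i
  simp only [flip, Function.update_self] at this
  exact units_ne_neg_self (σ a i) this.symm

lemma columnSum_flip_of_ne (σ : Config N y) (a : Fin y) {i j : Fin N} (hj : j ≠ i) :
    columnSum (flip σ a i) j = columnSum σ j := by
  refine Finset.sum_congr rfl fun b _ => ?_
  by_cases hb : b = a
  · subst hb; simp [flip, hj]
  · simp [flip, hb]

lemma weight_pos (γ : ℝ) (σ : Config N y) : 0 < weight γ σ := Real.exp_pos _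

lemma sum_weight_pos (γ : ℝ) : 0 < ∑ τ : Config N y, weight γ τ :=
  Finset.sum_pos (fun τ _ => weight_pos γ τ) Finset.univ_nonempty

lemma mu0_pos (γ : ℝ) (σ : Config N y) : 0 < mu0 γ σ := div_pos (weight_pos γ σ) (sum_weight_pos γ)

lemma sum_mu0 (γ : ℝ) : ∑ σ : Config N y, mu0 γ σ = 1 := by
  simp only [mu0, ← Finset.sum_div]
  exact div_self (sum_weight_pos γ).ne'

lemma weight_eq_prod (γ : ℝ) (σ : Config N y) :
    weight γ σ = ∏ i, Real.cosh (γ * columnSum σ i) := by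
  rw [weight, Real.exp_sum]
  exact Finset.prod_congr rfl fun i _ => Real.exp_log (Real.cosh_pos _)

/-- Only column `i` changes, so both sides are the common product over the other columns times the
smaller of the two hyperbolic cosines. -/
lemma weight_mul_min_flip (γ : ℝ) (σ : Config N y) (a : Fin y) (i : Fin N) :
    weight γ σ * min 1 (Real.cosh (γ * columnSum (flip σ a i) i) / Real.cosh (γ * columnSum σ i)) =
    weight γ (flip σ a i) *
      min 1 (Real.cosh (γ * columnSum σ i) / Real.cosh (γ * columnSum (flip σ a i) i)) := by
  have e : ∀ {u v : ℝ}, 0 < u → u * min 1 (v / u) = min u v := fun {u v} hu => by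
    rw [mul_min_of_nonneg _ _ hu.le, mul_one, mul_div_cancel₀ _ hu.ne']
  have h1 := Finset.mul_prod_erase Finset.univ
    (fun j => Real.cosh (γ * columnSum σ j)) (Finset.mem_univ i)
  have h2 := Finset.mul_prod_erase Finset.univ
    (fun j => Real.cosh (γ * columnSum (flip σ a i) j)) (Finset.mem_univ i)
  have h3 : ∏ j ∈ Finset.univ.erase i, Real.cosh (γ * columnSum (flip σ a i) j) =
      ∏ j ∈ Finset.univ.erase i, Real.cosh (γ * columnSum σ j) :=
    Finset.prod_congr rfl fun j hj => by rw [columnSum_flip_of_ne _ _ (Finset.ne_of_mem_erase hj)]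
  have e1 := e (v := Real.cosh (γ * columnSum (flip σ a i) i))
    (Real.cosh_pos (γ * columnSum σ i))
  have e2 := e (v := Real.cosh (γ * columnSum σ i))
    (Real.cosh_pos (γ * columnSum (flip σ a i) i))
  rw [min_comm (Real.cosh _)] at e2
  rw [weight_eq_prod, weight_eq_prod, ← h1, ← h2, h3, mul_right_comm, e1, mul_right_comm, e2]

lemma flip_eq_comm {σ τ : Config N y} {a : Fin y} {i : Fin N} :
    τ = flip σ a i ↔ σ = flip τ a i :=
  ⟨fun h => by rw [h, flip_flip], fun h => by rw [h, flip_flip]⟩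

lemma proposalOff_reversible (γ : ℝ) (σ τ : Config N y) :
    mu0 γ σ * proposalOff γ σ τ = mu0 γ τ * proposalOff γ τ σ := by
  rw [mu0, mu0, div_mul_eq_mul_div, div_mul_eq_mul_div]
  congr 1
  simp only [proposalOff, Finset.mul_sum]
  refine Finset.sum_congr rfl fun a _ => Finset.sum_congr rfl fun i _ => ?_
  by_cases h : τ = flip σ a i
  · rw [if_pos h, if_pos (flip_eq_comm.1 h), h, mul_left_comm, weight_mul_min_flip, mul_left_comm]
  · rw [if_neg h, if_neg (fun h' => h (flip_eq_comm.2 h')), mul_zero, mul_zero]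

lemma acceptance_pos (u v : ℝ) : 0 < min 1 (Real.cosh u / Real.cosh v) :=
  lt_min one_pos (div_pos (Real.cosh_pos _) (Real.cosh_pos _))

lemma proposalOff_nonneg (γ : ℝ) (σ τ : Config N y) : 0 ≤ proposalOff γ σ τ :=
  Finset.sum_nonneg fun a _ => Finset.sum_nonneg fun i _ => by
    split_ifs
    · exact mul_nonneg (by positivity) (acceptance_pos _ _).le
    · exact le_rfl

lemma proposalOff_flip_pos (γ : ℝ) (σ : Config N y) (a : Fin y) (i : Fin N) :
    0 < proposalOff γ σ (flip σ a i) := by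
  have hN : 0 < (N : ℝ) := Nat.cast_pos.2 i.pos
  have hy : 0 < (y : ℝ) := Nat.cast_pos.2 a.pos
  have hn : ∀ (b : Fin y) (j : Fin N), 0 ≤ (if flip σ a i = flip σ b j then
      1 / ((N : ℝ) * (y : ℝ)) *
      min 1 (Real.cosh (γ * columnSum (flip σ a i) j) / Real.cosh (γ * columnSum σ j)) else 0) :=
    fun b j => by
      split_ifs
      · exact mul_nonneg (by positivity) (acceptance_pos _ _).le
      · exact le_rfl
  refine Finset.sum_pos' (fun b _ => Finset.sum_nonneg fun j _ => hn b j)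
    ⟨a, Finset.mem_univ a, Finset.sum_pos' (fun j _ => hn a j) ⟨i, Finset.mem_univ i, ?_⟩⟩
  rw [if_pos rfl]
  exact mul_pos (by positivity) (acceptance_pos _ _)

lemma sum_proposalOff (γ : ℝ) (σ : Config N y) : ∑ ρ, proposalOff γ σ ρ =
    ∑ a : Fin y, ∑ i : Fin N, 1 / ((N : ℝ) * (y : ℝ)) *
      min 1 (Real.cosh (γ * columnSum (flip σ a i) i) / Real.cosh (γ * columnSum σ i)) := by
  simp only [proposalOff]
  rw [Finset.sum_comm]
  refine Finset.sum_congr rfl fun a _ => ?_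
  rw [Finset.sum_comm]
  refine Finset.sum_congr rfl fun i _ => ?_
  simp

lemma sum_uniform_le_one : ∑ _a : Fin y, ∑ _i : Fin N, 1 / ((N : ℝ) * (y : ℝ)) ≤ 1 := by
  rw [Finset.sum_const, Finset.sum_const]
  simp only [Finset.card_univ, Fintype.card_fin, nsmul_eq_mul]
  rw [← mul_assoc, mul_one_div, mul_comm (y : ℝ)]
  exact div_self_le_one _

lemma sum_proposalOff_le_one (γ : ℝ) (σ : Config N y) : ∑ ρ, proposalOff γ σ ρ ≤ 1 := by
  rw [sum_proposalOff]
  refine le_trans (Finset.sum_le_sum fun a _ => Finset.sum_le_sum fun i _ => ?_)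
    (sum_uniform_le_one (N := N) (y := y))
  exact mul_le_of_le_one_right (by positivity) (min_le_left _ _)

/-- From the fully aligned configuration some proposed flips are rejected. -/
lemma sum_proposalOff_one_lt_one (hy : 2 ≤ y) {γ : ℝ} (hγ : 0 < γ) :
    ∑ ρ, proposalOff γ (1 : Config N y) ρ < 1 := by
  rw [sum_proposalOff]
  rcases Nat.eq_zero_or_pos N with hN | hN
  · subst hN; simp
  · have hy0 : 0 < y := by omega
    have : Nonempty (Fin N) := ⟨⟨0, hN⟩⟩
    have : Nonempty (Fin y) := ⟨⟨0, hy0⟩⟩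
    have hN' : (0 : ℝ) < N := Nat.cast_pos.2 hN
    have hy' : (0 : ℝ) < y := Nat.cast_pos.2 hy0
    refine lt_of_lt_of_le (Finset.sum_lt_sum_of_nonempty Finset.univ_nonempty fun a _ =>
      Finset.sum_lt_sum_of_nonempty Finset.univ_nonempty fun i _ => ?_)
      (sum_uniform_le_one (N := N) (y := y))
    refine mul_lt_of_lt_one_right (by positivity) ((min_le_right _ _).trans_lt ?_)
    -- A flip lowers the column sum from `y` to `y - 2`; this strictly decreases the absolute value
    -- because `y ≥ 2`.
    rw [div_lt_one (Real.cosh_pos _), Real.cosh_lt_cosh]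
    have h1 : columnSum (1 : Config N y) i = y := by simp [columnSum]
    have h2 : columnSum (flip (1 : Config N y) a i) i = y - 2 := by
      have : ∀ b : Fin y, (((flip (1 : Config N y) a i) b i : ℤ) : ℝ) =
          1 - if b = a then 2 else 0 := fun b => by
        by_cases hb : b = a
        · subst hb; simp [flip]; norm_num
        · simp [flip, hb]
      simp only [columnSum, this, Finset.sum_sub_distrib]
      simp
    rw [h1, h2, abs_mul, abs_mul, abs_of_pos hγ]
    have : (2 : ℝ) ≤ y := by exact_mod_cast hy
    refine mul_lt_mul_of_pos_left ?_ hγ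
    rw [abs_of_nonneg (by linarith), abs_of_nonneg (by linarith)]
    linarith

lemma moveGraph_adj {σ τ : Config N y} : (moveGraph N y).Adj σ τ ↔ ∃ a i, τ = flip σ a i := by
  rw [moveGraph, SimpleGraph.fromRel_adj]
  constructor
  · rintro ⟨_, ⟨a, i, h⟩ | ⟨a, i, h⟩⟩
    · exact ⟨a, i, h⟩
    · exact ⟨a, i, flip_eq_comm.1 h⟩
  · rintro ⟨a, i, rfl⟩
    exact ⟨(flip_ne σ a i).symm, Or.inl ⟨a, i, rfl⟩⟩

lemma moveGraph_reachable (σ τ : Config N y) : (moveGraph N y).Reachable σ τ := by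
  classical
  -- Change `σ` into `τ` one site at a time, `s` being the set of sites already treated.
  have key : ∀ s : Finset (Fin y × Fin N), (moveGraph N y).Reachable σ
      (fun a i => if (a, i) ∈ s then τ a i else σ a i) := by
    intro s
    induction s using Finset.induction_on with
    | empty => simp
    | insert p s hp ih =>
      obtain ⟨a, i⟩ := p
      refine ih.trans ?_
      set ρ : Config N y := fun a i => if (a, i) ∈ s then τ a i else σ a i with hρ
      by_cases h : τ a i = σ a i
      · refine (congrArg ((moveGraph N y).Reachable ρ) ?_).mp (SimpleGraph.Reachable.refl ρ)
        ext b j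
        by_cases hb : (b, j) = (a, i)
        · obtain ⟨rfl, rfl⟩ := Prod.mk.inj hb
          simp [hρ, hp, h]
        · simp [hρ, Finset.mem_insert, hb]
      · refine SimpleGraph.Adj.reachable (moveGraph_adj.2 ⟨a, i, ?_⟩)
        ext b j
        by_cases hb : b = a
        · subst hb
          by_cases hj : j = i
          · subst hj
            have : τ b j = -σ b j := Int.units_ne_iff_eq_neg.1 h
            simp [flip, hρ, hp, this]
          · simp [flip, hρ, hj]
        · simp [flip, hρ, hb]
  have := key Finset.univ
  simpa using this

lemma exists_proposalOff_lower (N y : ℕ) (γ : ℝ) : ∃ c : ℝ, 0 < c ∧ c ≤ 1 ∧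
    ∀ σ τ : Config N y, (moveGraph N y).Adj σ τ → c ≤ proposalOff γ σ τ := by
  obtain ⟨c, h0, h1, h⟩ := exists_pos_forall_le
    (ι := {p : Config N y × Config N y // (moveGraph N y).Adj p.1 p.2})
    (f := fun p => proposalOff γ p.1.1 p.1.2) (fun p => by
      obtain ⟨a, i, h⟩ := moveGraph_adj.1 p.2
      rw [h]; exact proposalOff_flip_pos γ _ a i)
  exact ⟨c, h0, h1, fun σ τ hστ => h ⟨(σ, τ), hστ⟩⟩

variable {E : Spin N → ℝ} {γ β : ℝ}

lemma metropolisOff_of_ne {σ τ : Config N y} (h : τ ≠ σ) : metropolisOff E γ β σ τ =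
    Real.exp (-β * max (totalEnergy E τ - totalEnergy E σ) 0) * proposalOff γ σ τ := by
  rw [metropolisOff, proposal, if_neg h]

lemma metropolis_of_ne {σ τ : Config N y} (h : τ ≠ σ) : metropolis E γ β σ τ =
    Real.exp (-β * max (totalEnergy E τ - totalEnergy E σ) 0) * proposalOff γ σ τ := by
  rw [metropolis, if_neg h, metropolisOff_of_ne h]

lemma metropolisOff_le (hβ : 0 ≤ β) {σ τ : Config N y} (h : τ ≠ σ) :
    metropolisOff E γ β σ τ ≤ proposalOff γ σ τ := by
  rw [metropolisOff_of_ne h]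
  refine mul_le_of_le_one_left (proposalOff_nonneg γ σ τ) (Real.exp_le_one_iff.2 ?_)
  rw [neg_mul, neg_nonpos]
  exact mul_nonneg hβ (le_max_right _ _)

lemma sum_erase_metropolisOff_le (hβ : 0 ≤ β) (σ : Config N y) :
    ∑ ρ ∈ Finset.univ.erase σ, metropolisOff E γ β σ ρ ≤ ∑ ρ, proposalOff γ σ ρ :=
  (Finset.sum_le_sum fun _ hρ => metropolisOff_le hβ (Finset.ne_of_mem_erase hρ)).trans
    (Finset.sum_le_sum_of_subset_of_nonneg (Finset.subset_univ _)
      fun ρ _ _ => proposalOff_nonneg γ σ ρ)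

lemma metropolis_self (σ : Config N y) : metropolis E γ β σ σ =
    1 - ∑ ρ ∈ Finset.univ.erase σ, metropolisOff E γ β σ ρ := by
  rw [metropolis, if_pos rfl]

lemma metropolis_stochastic (hβ : 0 ≤ β) :
    (metropolis E γ β : Matrix (Config N y) (Config N y) ℝ) ∈ rowStochastic ℝ (Config N y) := by
  rw [mem_rowStochastic_iff_sum]
  constructor
  · intro σ τ
    by_cases h : τ = σ
    · subst h
      rw [metropolis_self, sub_nonneg]
      exact (sum_erase_metropolisOff_le hβ τ).trans (sum_proposalOff_le_one γ τ)
    · rw [metropolis_of_ne h]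
      exact mul_nonneg (Real.exp_pos _).le (proposalOff_nonneg γ σ τ)
  · intro σ
    rw [← Finset.add_sum_erase _ _ (Finset.mem_univ σ), metropolis_self]
    have : ∑ ρ ∈ Finset.univ.erase σ, metropolis E γ β σ ρ =
        ∑ ρ ∈ Finset.univ.erase σ, metropolisOff E γ β σ ρ :=
      Finset.sum_congr rfl fun ρ hρ => by rw [metropolis, if_neg (Finset.ne_of_mem_erase hρ)]
    rw [this]
    ring

/-- The numerator of `Qbar`. -/
def gibbsWeight (E : Spin N → ℝ) (γ β : ℝ) (σ : Config N y) : ℝ :=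
  Real.exp (-β * totalEnergy E σ) * mu0 γ σ

lemma gibbsWeight_pos (σ : Config N y) : 0 < gibbsWeight E γ β σ :=
  mul_pos (Real.exp_pos _) (mu0_pos γ σ)

lemma sum_gibbsWeight_pos : 0 < ∑ σ : Config N y, gibbsWeight E γ β σ :=
  Finset.sum_pos (fun _ _ => gibbsWeight_pos _) Finset.univ_nonempty

/-- The conductance of an edge depends on the energy only through the higher endpoint. This yields
reversibility, and it is why elevations of paths govern resistances. -/
lemma gibbsWeight_mul_metropolis {σ τ : Config N y} (h : τ ≠ σ) :
    gibbsWeight E γ β σ * metropolis E γ β σ τ =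
      Real.exp (-β * max (totalEnergy E σ) (totalEnergy E τ)) *
        (mu0 γ σ * proposalOff γ σ τ) := by
  have : max (totalEnergy E σ) (totalEnergy E τ) =
      totalEnergy E σ + max (totalEnergy E τ - totalEnergy E σ) 0 := by
    rw [← max_add_add_left, add_sub_cancel, add_zero, max_comm]
  rw [this, metropolis_of_ne h, gibbsWeight, mul_add, Real.exp_add]
  ring

lemma metropolis_reversible (σ τ : Config N y) :
    gibbsWeight E γ β σ * metropolis E γ β σ τ = gibbsWeight E γ β τ * metropolis E γ β τ σ := by
  by_cases h : τ = σ
  · rw [h]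
  · rw [gibbsWeight_mul_metropolis h, gibbsWeight_mul_metropolis (Ne.symm h), max_comm,
      proposalOff_reversible]

lemma Qbar_eq (σ : Config N y) :
    Qbar E γ β σ = gibbsWeight E γ β σ / ∑ τ : Config N y, gibbsWeight E γ β τ := rfl

lemma sum_Qbar : ∑ σ : Config N y, Qbar E γ β σ = 1 := by
  simp only [Qbar_eq, ← Finset.sum_div]
  exact div_self sum_gibbsWeight_pos.ne'

lemma Qbar_vecMul_metropolis (hβ : 0 ≤ β) :
    (Qbar E γ β : Config N y → ℝ) ᵥ* metropolis E γ β = Qbar E γ β := by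
  ext τ
  simp only [vecMul, dotProduct, Qbar_eq, div_mul_eq_mul_div]
  rw [← Finset.sum_div]
  congr 1
  simp_rw [metropolis_reversible (E := E) (γ := γ) (β := β) _ τ]
  rw [← Finset.mul_sum, sum_row_of_mem_rowStochastic (metropolis_stochastic hβ), mul_one]

lemma metropolis_self_le_one_aligned (hβ : 0 ≤ β) :
    1 - ∑ ρ, proposalOff γ (1 : Config N y) ρ ≤ metropolis E γ β (1 : Config N y) 1 := by
  rw [metropolis_self]
  exact sub_le_sub_left (sum_erase_metropolisOff_le hβ _) _

/-- A configuration with an uphill neighbour holds with a probability bounded below. -/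
lemma le_metropolis_self_of_uphill {b : ℝ} (hb : 0 ≤ b) (hβ : b ≤ β) {σ τ : Config N y}
    (hτ : totalEnergy E σ < totalEnergy E τ) :
    (1 - Real.exp (-b * (totalEnergy E τ - totalEnergy E σ))) * proposalOff γ σ τ ≤
      metropolis E γ β σ σ := by
  have hne : τ ≠ σ := by rintro rfl; exact lt_irrefl _ hτ
  have hmem : τ ∈ Finset.univ.erase σ := Finset.mem_erase.2 ⟨hne, Finset.mem_univ τ⟩
  have hβ0 : 0 ≤ β := hb.trans hβ
  rw [metropolis_self, ← Finset.add_sum_erase _ _ hmem]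
  have h1 : ∑ ρ ∈ (Finset.univ.erase σ).erase τ, metropolisOff E γ β σ ρ ≤
      ∑ ρ ∈ (Finset.univ.erase σ).erase τ, proposalOff γ σ ρ :=
    Finset.sum_le_sum fun ρ hρ =>
      metropolisOff_le hβ0 (Finset.ne_of_mem_erase (Finset.mem_of_mem_erase hρ))
  have h2 : proposalOff γ σ τ + ∑ ρ ∈ (Finset.univ.erase σ).erase τ, proposalOff γ σ ρ ≤ 1 := by
    rw [Finset.add_sum_erase _ _ hmem]
    exact (Finset.sum_le_sum_of_subset_of_nonneg (Finset.subset_univ _)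
      fun ρ _ _ => proposalOff_nonneg γ σ ρ).trans (sum_proposalOff_le_one γ σ)
  have h3 : metropolisOff E γ β σ τ ≤
      Real.exp (-b * (totalEnergy E τ - totalEnergy E σ)) * proposalOff γ σ τ := by
    rw [metropolisOff_of_ne hne, max_eq_left (sub_nonneg.2 hτ.le)]
    refine mul_le_mul_of_nonneg_right (Real.exp_le_exp.2 ?_) (proposalOff_nonneg γ σ τ)
    exact mul_le_mul_of_nonneg_right (neg_le_neg hβ) (sub_nonneg.2 hτ.le)
  linarith

end Metropolis

/-! ### Energy barriers and contraction at low temperature -/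

section Landscape

open Matrix

variable {N y : ℕ} {E : Spin N → ℝ} {γ β : ℝ}

lemma totalEnergy_nonneg (hE : ∀ s, 0 ≤ E s) (σ : Config N y) : 0 ≤ totalEnergy E σ :=
  Finset.sum_nonneg fun _ _ => hE _

lemma le_elev {σ τ ρ : Config N y} (p : (moveGraph N y).Walk σ τ) (h : ρ ∈ p.support) :
    totalEnergy E ρ ≤ elev E p :=
  Finset.le_sup' (totalEnergy E) (List.mem_toFinset.2 h)

/-- Any two configurations are joined by a path whose elevation is controlled by the barrier. -/
lemma exists_walk_elev_le (σ τ : Config N y) : ∃ p : (moveGraph N y).Walk σ τ,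
    elev E p ≤ totalEnergy E σ + totalEnergy E τ + barrier E y := by
  have : Nonempty ((moveGraph N y).Walk σ τ) := moveGraph_reachable σ τ
  -- There may be infinitely many walks, but elevations are values of the energy, so the infimum is
  -- attained.
  have hfin : (Set.range fun p : (moveGraph N y).Walk σ τ => elev E p).Finite := by
    refine (Set.finite_range (totalEnergy E : Config N y → ℝ)).subset ?_
    rintro _ ⟨p, rfl⟩
    obtain ⟨ρ, _, h⟩ := Finset.exists_mem_eq_sup' (s := p.support.toFinset) ⟨σ, by simp⟩
      (totalEnergy E)
    exact ⟨ρ, h.symm⟩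
  obtain ⟨p, hp⟩ := (Set.range_nonempty _).csInf_mem hfin
  refine ⟨p, ?_⟩
  have h1 : height E σ τ - totalEnergy E σ - totalEnergy E τ ≤ barrier E y :=
    Finset.le_sup' (fun p : Config N y × Config N y =>
      height E p.1 p.2 - totalEnergy E p.1 - totalEnergy E p.2) (Finset.mem_univ (σ, τ))
  have h2 : elev E p = height E σ τ := hp
  linarith

/-- With no barriers, every configuration descends to `h` without ever going uphill. -/
lemma reflTransGen_of_barrier_nonpos (hm : barrier E y ≤ 0) {h : Config N y}
    (hh : totalEnergy E h = 0) (σ : Config N y) :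
    Relation.ReflTransGen (fun x w => ((moveGraph N y).Adj x w ∧ totalEnergy E w ≤ totalEnergy E x)
      ∨ (x = h ∧ w = h)) σ h := by
  have hwf : WellFounded fun x w : Config N y => totalEnergy E x < totalEnergy E w := by
    have : IsTrans (Config N y) fun x w => totalEnergy E x < totalEnergy E w :=
      ⟨fun _ _ _ => lt_trans⟩
    have : Std.Irrefl fun x w : Config N y => totalEnergy E x < totalEnergy E w :=
      ⟨fun _ => lt_irrefl _⟩
    exact Finite.wellFounded_of_trans_of_irrefl _
  induction σ using hwf.induction with
  | _ σ ih =>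
    obtain ⟨p, hp⟩ := exists_walk_elev_le (E := E) σ h
    have hsup : ∀ v ∈ p.support, totalEnergy E v ≤ totalEnergy E σ := fun v hv => by
      have := le_elev (E := E) p hv
      linarith
    -- Follow the walk as long as the energy stays level; at the first strict drop, the induction on
    -- energy takes over.
    have inner : ∀ {u w : Config N y} (q : (moveGraph N y).Walk u w), w = h →
        totalEnergy E u = totalEnergy E σ → (∀ v ∈ q.support, totalEnergy E v ≤ totalEnergy E σ) →
        Relation.ReflTransGen (fun x w => ((moveGraph N y).Adj x w ∧
          totalEnergy E w ≤ totalEnergy E x) ∨ (x = h ∧ w = h)) u h := by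
      intro u w q
      induction q with
      | nil => rintro rfl _ _; exact Relation.ReflTransGen.refl
      | @cons u v w huv q ihq =>
        intro hw hu hq
        have hv : totalEnergy E v ≤ totalEnergy E σ := hq v (by simp)
        refine Relation.ReflTransGen.head (Or.inl ⟨huv, hv.trans hu.ge⟩) ?_
        rcases hv.lt_or_eq with hlt | heq
        · exact ih v hlt
        · exact ihq hw heq fun z hz => hq z (by simp [hz])
    exact inner p rfl rfl hsup

/-- A nonconstant energy has a ground state with an uphill neighbour. -/
lemma exists_uphill (hy : 0 < y) (hE : ∀ s, 0 ≤ E s) {s₀ s₁ : Spin N} (h₀ : E s₀ = 0)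
    (h₁ : E s₁ ≠ 0) : ∃ σ τ : Config N y, (moveGraph N y).Adj σ τ ∧ totalEnergy E σ = 0 ∧
      0 < totalEnergy E τ := by
  obtain ⟨p⟩ := moveGraph_reachable (fun _ => s₀ : Config N y) (fun _ => s₁)
  obtain ⟨d, _, hd1, hd2⟩ := p.exists_boundary_dart {σ | totalEnergy E σ = 0}
    (by simp [totalEnergy, h₀]) (by simp [totalEnergy, h₁, hy.ne'])
  exact ⟨d.fst, d.snd, d.adj, hd1, (totalEnergy_nonneg hE _).lt_of_ne' hd2⟩

lemma abs_sub_le_of_walk {V : Type*} {G : SimpleGraph V} {g : V → ℝ} {b : ℝ} {u w : V}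
    (p : G.Walk u w) (h : ∀ x ∈ p.support, ∀ z ∈ p.support, G.Adj x z → |g x - g z| ≤ b) :
    |g u - g w| ≤ p.length * b := by
  induction p with
  | nil => simp
  | @cons u v w huv p ih =>
    have h1 := h u (by simp) v (by simp) huv
    have h2 := ih fun x hx z hz => h x (by simp [hx]) z (by simp [hz])
    rw [SimpleGraph.Walk.length_cons]
    push_cast
    have := abs_sub_le (g u) (g v) (g w)
    linarith

/-- A single edge of conductance at least `κ` bounds increments by the Dirichlet form. -/
lemma mul_sq_le_dirichlet {α : Type*} [Fintype α] {q : α → ℝ} {S : Matrix α α ℝ}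
    (hqS : ∀ x z, 0 ≤ q x * S x z) (g : α → ℝ) {x z : α} {κ : ℝ} (hκ : κ ≤ q x * S x z) :
    κ * (g x - g z) ^ 2 ≤ 2 * dirichlet q S g := by
  have hn : ∀ u v, 0 ≤ q u * S u v * (g u - g v) ^ 2 := fun u v => mul_nonneg (hqS u v) (sq_nonneg _)
  rw [dirichlet, ← mul_assoc, mul_one_div_cancel two_ne_zero, one_mul]
  calc κ * (g x - g z) ^ 2 ≤ q x * S x z * (g x - g z) ^ 2 :=
        mul_le_mul_of_nonneg_right hκ (sq_nonneg _)
    _ ≤ ∑ v, q x * S x v * (g x - g v) ^ 2 :=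
        Finset.single_le_sum (f := fun v => q x * S x v * (g x - g v) ^ 2)
          (fun v _ => hn x v) (Finset.mem_univ z)
    _ ≤ _ := Finset.single_le_sum (f := fun u => ∑ v, q u * S u v * (g u - g v) ^ 2)
        (fun u _ => Finset.sum_nonneg fun v _ => hn u v) (Finset.mem_univ x)

/-- Hitting times of a ground state are at most of order `exp (β m)`. -/
lemma exists_survival_le (E : Spin N → ℝ) (γ : ℝ) {h : Config N y} (hh : totalEnergy E h = 0) :
    ∃ C : ℝ, 0 ≤ C ∧ ∀ β, 0 ≤ β → ∀ (n : ℕ) (x : Config N y),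
      n * survival (metropolis E γ β) h n x ≤ C * Real.exp (β * barrier E y) := by
  obtain ⟨c, hc0, -, hc⟩ := exists_proposalOff_lower N y γ
  obtain ⟨μ, hμ0, -, hμ⟩ := exists_pos_forall_le (mu0_pos (N := N) (y := y) γ)
  choose p hp using fun w : Config N y => exists_walk_elev_le (E := E) w h
  -- Every edge of the path has conductance at least `μ c exp (-β (U(w) + m))`. Summing the
  -- increments along the path gives the resistance bound `ℓ w * exp (β (U(w) + m))`.
  set ℓ : Config N y → ℝ := fun w => 2 * ((p w).length : ℝ) ^ 2 / (μ * c) with hℓ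
  have hℓ0 : ∀ w, 0 ≤ ℓ w := fun w => by positivity
  refine ⟨∑ w, ℓ w * mu0 γ w,
    Finset.sum_nonneg fun w _ => mul_nonneg (hℓ0 w) (mu0_pos γ w).le, fun β hβ n x => ?_⟩
  set ρ : Config N y → ℝ := fun w => ℓ w * Real.exp (β * (totalEnergy E w + barrier E y)) with hρ
  have hst := metropolis_stochastic (N := N) (y := y) (E := E) (γ := γ) hβ
  have hqS : ∀ x z : Config N y, 0 ≤ gibbsWeight E γ β x * metropolis E γ β x z := fun x z =>
    mul_nonneg (gibbsWeight_pos x).le (hst.1 x z)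
  have hres : ∀ (w : Config N y) (g : Config N y → ℝ),
      (g w - g h) ^ 2 ≤ ρ w * dirichlet (gibbsWeight E γ β) (metropolis E γ β) g := by
    intro w g
    set κ := μ * c * Real.exp (-β * (totalEnergy E w + barrier E y)) with hκ
    have hκ0 : 0 < κ := by positivity
    set D := dirichlet (gibbsWeight E γ β) (metropolis E γ β) g with hD
    have hD0 : 0 ≤ D := by
      rw [hD, dirichlet]
      exact mul_nonneg (by norm_num) (Finset.sum_nonneg fun u _ => Finset.sum_nonneg fun v _ =>
        mul_nonneg (hqS u v) (sq_nonneg _))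
    have hedge : ∀ x ∈ (p w).support, ∀ z ∈ (p w).support, (moveGraph N y).Adj x z →
        |g x - g z| ≤ Real.sqrt (2 * D / κ) := by
      intro x hx z hz hxz
      have hlow : κ ≤ gibbsWeight E γ β x * metropolis E γ β x z := by
        rw [gibbsWeight_mul_metropolis hxz.ne', hκ, mul_comm]
        refine mul_le_mul (Real.exp_le_exp.2 ?_)
          (mul_le_mul (hμ x) (hc x z hxz) hc0.le (mu0_pos γ x).le) (by positivity)
          (Real.exp_pos _).le
        have h1 := (le_elev (E := E) (p w) hx).trans (hp w)
        have h2 := (le_elev (E := E) (p w) hz).trans (hp w)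
        rw [neg_mul, neg_mul]
        refine neg_le_neg (mul_le_mul_of_nonneg_left (max_le ?_ ?_) hβ) <;> linarith
      refine Real.abs_le_sqrt ?_
      rw [le_div_iff₀ hκ0, mul_comm]
      exact mul_sq_le_dirichlet hqS g hlow
    have h1 := abs_sub_le_of_walk (p w) hedge
    have h2 : (g w - g h) ^ 2 ≤ ((p w).length * Real.sqrt (2 * D / κ)) ^ 2 := by
      rw [← sq_abs]
      exact pow_le_pow_left₀ (abs_nonneg _) h1 2
    refine h2.trans (le_of_eq ?_)
    rw [mul_pow, Real.sq_sqrt (by positivity), hρ, hℓ, hκ, neg_mul, Real.exp_neg]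
    field_simp
  refine (survival_le (fun x => (gibbsWeight_pos x).le) hst metropolis_reversible
    (fun w => by positivity) hres n x).trans (le_of_eq ?_)
  rw [Finset.sum_mul]
  refine Finset.sum_congr rfl fun w _ => ?_
  simp only [hρ, gibbsWeight]
  -- The Gibbs factor of the pole `w` cancels `exp (β U(w))`, leaving `exp (β m)` for every pole.
  rw [mul_add, Real.exp_add, neg_mul, Real.exp_neg]
  field_simp

/-- A ground state with positive holding probability has return probabilities bounded below. -/
lemma mul_mu0_le_pow_self (hE : ∀ s, 0 ≤ E s) (hβ : 0 ≤ β) {h : Config N y}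
    (hh : totalEnergy E h = 0) {c : ℝ} (hc1 : c ≤ 1)
    (hc : c ≤ metropolis E γ β h h) (n : ℕ) :
    c * mu0 γ h ≤ (metropolis E γ β ^ n) h h := by
  have hst := metropolis_stochastic (N := N) (y := y) (E := E) (γ := γ) hβ
  have heven : ∀ k, mu0 γ h ≤ (metropolis E γ β ^ (2 * k)) h h := by
    intro k
    refine le_trans ?_ (div_sum_le_pow_even (fun x => gibbsWeight_pos x) hst
      metropolis_reversible k h)
    rw [le_div_iff₀ sum_gibbsWeight_pos]
    have h1 : ∑ x : Config N y, gibbsWeight E γ β x ≤ 1 := by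
      rw [← sum_mu0 (N := N) (y := y) γ]
      refine Finset.sum_le_sum fun x _ => mul_le_of_le_one_left (mu0_pos γ x).le ?_
      rw [Real.exp_le_one_iff, neg_mul, neg_nonpos]
      exact mul_nonneg hβ (totalEnergy_nonneg hE x)
    have h2 : gibbsWeight E γ β h = mu0 γ h := by simp [gibbsWeight, hh]
    rw [h2]
    exact mul_le_of_le_one_right (mu0_pos γ h).le h1
  rcases Nat.even_or_odd' n with ⟨k, rfl | rfl⟩
  · exact (mul_le_of_le_one_left (mu0_pos γ h).le hc1).trans (heven k)
  · rw [pow_succ', Matrix.mul_apply]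
    have hst' : metropolis E γ β ^ (2 * k) ∈ rowStochastic ℝ (Config N y) := pow_mem hst _
    calc c * mu0 γ h ≤ metropolis E γ β h h * (metropolis E γ β ^ (2 * k)) h h :=
          mul_le_mul hc (heven k) (mu0_pos γ h).le (hst.1 h h)
      _ ≤ _ := Finset.single_le_sum
          (f := fun x => metropolis E γ β h x * (metropolis E γ β ^ (2 * k)) x h)
          (fun x _ => mul_nonneg (hst.1 h x) (hst'.1 x h)) (Finset.mem_univ h)

/-- At large inverse temperature, `δ exp (β m)` steps contract by a uniform factor. -/
lemma exists_contracts_metropolis_pow (hE : ∀ s, 0 ≤ E s) {h : Config N y}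
    (hh : totalEnergy E h = 0) {b c δ : ℝ} (hb : 0 ≤ b) (hc0 : 0 < c) (hc1 : c ≤ 1)
    (hc : ∀ β, b ≤ β → c ≤ metropolis E γ β h h) (hδ : 0 < δ) :
    ∃ (L : ℕ) (r : ℝ), 0 ≤ r ∧ r < 1 ∧ ∀ β, b ≤ β → ∀ n : ℕ, L ≤ n →
      δ * Real.exp (β * barrier E y) ≤ n →
      Contracts (metropolis E γ β ^ n : Matrix (Config N y) (Config N y) ℝ) r := by
  obtain ⟨C, hC0, hC⟩ := exists_survival_le E γ hh
  have hμ := mu0_pos γ h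
  have hμ1 : mu0 γ h ≤ 1 := by
    rw [← sum_mu0 (N := N) (y := y) γ]
    exact Finset.single_le_sum (fun x _ => (mu0_pos γ x).le) (Finset.mem_univ h)
  have hc' : 0 < c * mu0 γ h := mul_pos hc0 hμ
  have hc'1 : c * mu0 γ h ≤ 1 := mul_le_one₀ hc1 hμ.le hμ1
  -- By Markov's inequality the survival probability is at most `1 / 2` after `2 * C * exp (β m)`
  -- steps, which halves the return bound `c * mu0 γ h`; the extra `1` keeps the time positive when
  -- `C = 0`.
  obtain ⟨L, r, hr0, hr1, hL⟩ := exists_contracts_pow (Config N y) (c := c * mu0 γ h / 2)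
    (C := 2 * C + 1) (by positivity) (by linarith) hδ
  refine ⟨L, r, hr0, hr1, fun β hβ n hn hδn => ?_⟩
  have hβ0 := hb.trans hβ
  have hst := metropolis_stochastic (N := N) (y := y) (E := E) (γ := γ) hβ0
  have hret := mul_mu0_le_pow_self hE hβ0 hh hc1 (hc β hβ)
  refine hL _ h (Real.exp (β * barrier E y)) hst (Real.exp_pos _).le
    (fun k => by have := hret k; linarith) (fun k x hk => ?_) n hn hδn
  refine le_trans ?_ (le_pow_apply_target hst hret k x)
  have h1 := hC β hβ0 k x
  have hexp := Real.exp_pos (β * barrier E y)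
  have hs : survival (metropolis E γ β) h k x ≤ 1 / 2 := by
    have hk0 : (0 : ℝ) < k := lt_of_lt_of_le (by positivity) hk
    have h2 : (k : ℝ) * survival (metropolis E γ β) h k x ≤ k * (1 / 2) := by nlinarith
    exact le_of_mul_le_mul_left h2 hk0
  nlinarith

end Landscape

/-! ### Increments of the invariant measures -/

section Convergence

open Matrix

variable {N y : ℕ} {E : Spin N → ℝ} {γ : ℝ}

/-- The normalizing constant of `Qbar`. -/
def partitionFn (E : Spin N → ℝ) (y : ℕ) (γ β : ℝ) : ℝ := ∑ τ : Config N y, gibbsWeight E γ β τ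

lemma gibbsWeight_anti (hE : ∀ s, 0 ≤ E s) {β β' : ℝ} (h : β ≤ β') (σ : Config N y) :
    gibbsWeight E γ β' σ ≤ gibbsWeight E γ β σ :=
  mul_le_mul_of_nonneg_right (Real.exp_le_exp.2
    (mul_le_mul_of_nonneg_right (neg_le_neg h) (totalEnergy_nonneg hE σ))) (mu0_pos γ σ).le

lemma mu0_le_partitionFn {β : ℝ} {h : Config N y} (hh : totalEnergy E h = 0) :
    mu0 γ h ≤ partitionFn E y γ β := by
  have : gibbsWeight E γ β h = mu0 γ h := by simp [gibbsWeight, hh]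
  rw [← this]
  exact Finset.single_le_sum (fun x _ => (gibbsWeight_pos x).le) (Finset.mem_univ h)

/-- All Gibbs weights decrease in `β`, so each loses at most what the partition function loses, and
`mu0 γ h` bounds every partition function from below. The form of the bound is chosen to telescope.
-/
lemma abs_Qbar_sub_le (hE : ∀ s, 0 ≤ E s) {β β' : ℝ} (hβ : β ≤ β') {h : Config N y}
    (hh : totalEnergy E h = 0) (σ : Config N y) :
    |Qbar E γ β σ - Qbar E γ β' σ| ≤
      2 / mu0 γ h * (partitionFn E y γ β - partitionFn E y γ β') := by
  have hz := mu0_pos γ h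
  have hZ := mu0_le_partitionFn (γ := γ) (β := β) hh
  have hZ' := mu0_le_partitionFn (γ := γ) (β := β') hh
  have hQ : ∀ b, Qbar E γ b σ = gibbsWeight E γ b σ / partitionFn E y γ b := fun _ => rfl
  rw [hQ, hQ]
  have ha' : gibbsWeight E γ β' σ ≤ partitionFn E y γ β' :=
    Finset.single_le_sum (fun x _ => (gibbsWeight_pos x).le) (Finset.mem_univ σ)
  have hd : gibbsWeight E γ β σ - gibbsWeight E γ β' σ ≤
      partitionFn E y γ β - partitionFn E y γ β' := by
    rw [partitionFn, partitionFn, ← Finset.sum_sub_distrib]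
    exact Finset.single_le_sum
      (f := fun x : Config N y => gibbsWeight E γ β x - gibbsWeight E γ β' x)
      (fun x _ => sub_nonneg.2 (gibbsWeight_anti hE hβ x)) (Finset.mem_univ σ)
  have ha := gibbsWeight_anti (γ := γ) hE hβ σ
  have ha0 : 0 < gibbsWeight E γ β' σ := gibbsWeight_pos σ
  generalize gibbsWeight E γ β σ = a at *
  generalize gibbsWeight E γ β' σ = a' at *
  generalize partitionFn E y γ β = Z at *
  generalize partitionFn E y γ β' = Z' at *
  have hZp : 0 < Z := hz.trans_le hZ
  have hZp' : 0 < Z' := hz.trans_le hZ'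
  have e : a / Z - a' / Z' = (a - a') / Z - a' / Z' * ((Z - Z') / Z) := by
    field_simp
    ring
  have h1 : (a - a') / Z ≤ (Z - Z') / mu0 γ h :=
    div_le_div₀ (by linarith) hd hz hZ
  have h2 : (Z - Z') / Z ≤ (Z - Z') / mu0 γ h := div_le_div₀ (by linarith) le_rfl hz hZ
  have h3 : a' / Z' ≤ 1 := (div_le_one hZp').2 ha'
  have h4 : 0 ≤ (Z - Z') / Z := div_nonneg (by linarith) hZp.le
  have h5 : 0 ≤ (a - a') / Z := div_nonneg (by linarith) hZp.le
  have h6 : 0 ≤ a' / Z' := (div_pos ha0 hZp').le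
  have h7 : a' / Z' * ((Z - Z') / Z) ≤ (Z - Z') / Z := mul_le_of_le_one_left h4 h3
  have h8 := mul_nonneg h6 h4
  have e2 : 2 / mu0 γ h * (Z - Z') = 2 * ((Z - Z') / mu0 γ h) := by ring
  rw [e, e2, abs_le]
  constructor <;> linarith

lemma energyGap_le (hE : ∀ s, 0 ≤ E s) {σ : Config N y} (hσ : totalEnergy E σ ≠ 0) :
    energyGap E ≤ totalEnergy E σ := by
  obtain ⟨a, _, ha⟩ := Finset.exists_ne_zero_of_sum_ne_zero hσ
  have h1 : energyGap E ≤ E (σ a) :=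
    csInf_le ⟨0, by rintro b ⟨s, -, rfl⟩; exact hE s⟩ ⟨σ a, ha, rfl⟩
  exact h1.trans (Finset.single_le_sum (f := fun a => E (σ a)) (fun a _ => hE (σ a))
    (Finset.mem_univ a))

/-- Ground states have weights independent of the temperature; every other configuration has energy
at least the gap. -/
lemma partitionFn_sub_le (hE : ∀ s, 0 ≤ E s) {β β' : ℝ} (hβ : 0 ≤ β) :
    partitionFn E y γ β - partitionFn E y γ β' ≤ Real.exp (-β * energyGap E) := by
  rw [partitionFn, partitionFn, ← Finset.sum_sub_distrib]
  calc ∑ σ : Config N y, (gibbsWeight E γ β σ - gibbsWeight E γ β' σ)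
      ≤ ∑ σ : Config N y, Real.exp (-β * energyGap E) * mu0 γ σ := by
        refine Finset.sum_le_sum fun σ _ => ?_
        by_cases hσ : totalEnergy E σ = 0
        · simp only [gibbsWeight, hσ, mul_zero, sub_self]
          exact mul_nonneg (Real.exp_pos _).le (mu0_pos γ σ).le
        · refine (sub_le_self _ (gibbsWeight_pos σ).le).trans ?_
          refine mul_le_mul_of_nonneg_right (Real.exp_le_exp.2 ?_) (mu0_pos γ σ).le
          rw [neg_mul, neg_mul]
          exact neg_le_neg (mul_le_mul_of_nonneg_left (energyGap_le hE hσ) hβ)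
    _ = _ := by rw [← Finset.mul_sum, sum_mu0, mul_one]

lemma exists_incrementBound (hE : ∀ s, 0 ≤ E s) {β : ℕ → ℝ} (hβ₀ : ∀ n, 1 ≤ n → 0 ≤ β n)
    (hβ : ∀ n, 1 ≤ n → β n ≤ β (n + 1)) {h : Config N y} (hh : totalEnergy E h = 0) :
    ∃ κ : ℝ, 1 < κ ∧ IncrementBound E y γ β κ := by
  have hz := div_pos two_pos (mu0_pos γ h)
  refine ⟨2 / mu0 γ h + 1, by linarith, fun n hn => ?_⟩
  refine (pi_norm_le_iff_of_nonneg (by positivity)).2 fun σ => ?_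
  rw [Real.norm_eq_abs, Pi.sub_apply]
  refine (abs_Qbar_sub_le hE (hβ n hn) hh σ).trans ?_
  have h1 := partitionFn_sub_le (y := y) (γ := γ) (β' := β (n + 1)) hE (hβ₀ n hn)
  have h2 := mul_le_mul_of_nonneg_left h1 hz.le
  have := Real.exp_pos (-β n * energyGap E)
  linarith

lemma summable_Qbar_increments (hE : ∀ s, 0 ≤ E s) {β : ℕ → ℝ}
    (hβ : ∀ n, 1 ≤ n → β n ≤ β (n + 1)) {h : Config N y} (hh : totalEnergy E h = 0) :
    Summable fun n => ∑ σ : Config N y, |Qbar E γ (β n) σ - Qbar E γ (β (n + 1)) σ| := by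
  rw [← summable_nat_add_iff 1]
  set Z : ℕ → ℝ := fun n => partitionFn E y γ (β (n + 1)) with hZ
  set C : ℝ := Fintype.card (Config N y) * (2 / mu0 γ h) with hC
  have hC0 : 0 ≤ C := mul_nonneg (Nat.cast_nonneg _) (div_pos two_pos (mu0_pos γ h)).le
  refine summable_of_sum_range_le (c := C * Z 0)
    (fun n => Finset.sum_nonneg fun _ _ => abs_nonneg _) fun n => ?_
  calc _ ≤ ∑ i ∈ Finset.range n, C * (Z i - Z (i + 1)) := by
        refine Finset.sum_le_sum fun i _ => ?_
        refine (Finset.sum_le_sum fun σ _ => abs_Qbar_sub_le hE (hβ (i + 1) (by omega)) hh σ).trans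
          (le_of_eq ?_)
        rw [Finset.sum_const, nsmul_eq_mul, Finset.card_univ, ← mul_assoc]
    _ = C * (Z 0 - Z n) := by rw [← Finset.mul_sum, Finset.sum_range_sub']
    _ ≤ C * Z 0 := by
        refine mul_le_mul_of_nonneg_left (sub_le_self _ ?_) hC0
        exact sum_gibbsWeight_pos.le

/-! ### Weak ergodicity of the annealing chain -/

lemma boundedBelow_metropolis {β : ℝ} (hβ : 0 ≤ β) {R : Config N y → Config N y → Prop} {ε : ℝ}
    {h : Config N y} {c C : ℝ} (hc : ∀ σ τ, (moveGraph N y).Adj σ τ → c ≤ proposalOff γ σ τ)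
    (hc0 : 0 ≤ c) (hhold : ε ≤ metropolis E γ β h h) (hεc : ε ≤ Real.exp (-C) * c)
    (hR : ∀ σ τ, R σ τ → ((moveGraph N y).Adj σ τ ∧
      β * max (totalEnergy E τ - totalEnergy E σ) 0 ≤ C) ∨ (σ = h ∧ τ = h)) :
    BoundedBelow R ε (metropolis E γ β) := by
  refine ⟨metropolis_stochastic hβ, fun σ τ hστ => ?_⟩
  rcases hR σ τ hστ with ⟨hadj, hC⟩ | ⟨rfl, rfl⟩
  · rw [metropolis_of_ne hadj.ne']
    refine hεc.trans (mul_le_mul (Real.exp_le_exp.2 ?_) (hc σ τ hadj) hc0 (Real.exp_pos _).le)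
    rw [neg_mul]
    exact neg_le_neg hC
  · exact hhold

lemma reflTransGen_of_adj {R : Config N y → Config N y → Prop}
    (hR : ∀ σ τ, (moveGraph N y).Adj σ τ → R σ τ) (σ τ : Config N y) :
    Relation.ReflTransGen R σ τ :=
  Relation.ReflTransGen.mono hR _ _
    ((SimpleGraph.reachable_iff_reflTransGen σ τ).1 (moveGraph_reachable σ τ))

/-- The annealing chain is weakly ergodic as soon as infinitely many stages last at least a fixed
multiple of `exp (β m)`. -/
lemma exists_forgets (hy : 2 ≤ y) (hγ : 0 < γ) (hE : IsLeast (Set.range E) 0) {β : ℕ → ℝ}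
    (hβ₀ : ∀ n, 1 ≤ n → 0 ≤ β n) (hβ : ∀ n, 1 ≤ n → β n ≤ β (n + 1)) {T : ℕ → ℕ} {δ : ℝ}
    (hδ : 0 < δ) (hT : ∃ᶠ n in atTop, δ ≤ T n * Real.exp (-β n * barrier E y)) :
    ∃ k₀, 1 ≤ k₀ ∧ ∀ k, k₀ ≤ k →
      Forgets (fun n => (metropolis E γ (β n) : Matrix (Config N y) (Config N y) ℝ) ^ T n) k := by
  have hE0 : ∀ s, 0 ≤ E s := fun s => hE.2 ⟨s, rfl⟩
  obtain ⟨c, hc0, hc1, hc⟩ := exists_proposalOff_lower N y γ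
  have hT1 : ∃ᶠ n in atTop, 1 ≤ T n := hT.mono fun n hn => by
    by_contra h0
    have : T n = 0 := by omega
    rw [this, Nat.cast_zero, zero_mul] at hn
    linarith
  have hmono : ∀ a b, 1 ≤ a → a ≤ b → β a ≤ β b := fun a b ha hab => by
    induction hab with
    | refl => exact le_rfl
    | @step i hi ih => exact ih.trans (hβ i (ha.trans hi))
  -- This covers bounded `β` as well as `E = 0`. All moves keep probabilities bounded below, and
  -- aperiodicity comes from the rejections of the reference dynamics at the aligned configuration
  -- `1`. Otherwise `β n → ∞` and `E` is not identically zero.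
  by_cases hbd : ∃ C : ℝ, ∀ n, 1 ≤ n → ∀ σ : Config N y, β n * totalEnergy E σ ≤ C
  · obtain ⟨C, hC⟩ := hbd
    have hhold := sum_proposalOff_one_lt_one (N := N) hy hγ
    set ε := min (Real.exp (-C) * c) (1 - ∑ ρ, proposalOff γ (1 : Config N y) ρ) with hε
    have hε0 : 0 < ε := lt_min (by positivity) (by linarith)
    have hε1 : ε ≤ 1 := (min_le_right _ _).trans (sub_le_self _
      (Finset.sum_nonneg fun ρ _ => proposalOff_nonneg γ _ ρ))
    refine ⟨1, le_rfl, fun k hk => forgets_of_boundedBelow (h := 1)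
      (R := fun σ τ => (moveGraph N y).Adj σ τ ∨ (σ = 1 ∧ τ = 1)) hε0 hε1 (Or.inr ⟨rfl, rfl⟩)
      (fun σ => reflTransGen_of_adj (fun _ _ => Or.inl) σ 1) (fun n hn => ?_) hT1⟩
    have hn1 : 1 ≤ n := hk.trans hn
    refine boundedBelow_metropolis (h := 1) (C := C) (hβ₀ n hn1) hc hc0.le
      ((min_le_right _ _).trans (metropolis_self_le_one_aligned (hβ₀ n hn1))) (min_le_left _ _)
      fun σ τ h => h.imp_left fun hadj => ⟨hadj, ?_⟩
    refine le_trans (mul_le_mul_of_nonneg_left (max_le ?_ ?_) (hβ₀ n hn1)) (hC n hn1 τ)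
    · exact sub_le_self _ (totalEnergy_nonneg hE0 σ)
    · exact totalEnergy_nonneg hE0 τ
  · push Not at hbd
    have hlarge : ∀ b : ℝ, ∀ᶠ n in atTop, b ≤ β n := by
      intro b
      obtain ⟨n, hn, σ, hσ⟩ := hbd (|b| * ∑ τ : Config N y, totalEnergy E τ)
      have h1 : totalEnergy E σ ≤ ∑ τ : Config N y, totalEnergy E τ :=
        Finset.single_le_sum (fun τ _ => totalEnergy_nonneg hE0 τ) (Finset.mem_univ σ)
      have hb : b ≤ β n := by
        by_contra hlt
        have h2 : β n ≤ |b| := (not_le.1 hlt).le.trans (le_abs_self b)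
        exact absurd hσ (not_lt.2 (mul_le_mul h2 h1 (totalEnergy_nonneg hE0 σ) (abs_nonneg b)))
      filter_upwards [eventually_ge_atTop n] with k hk using hb.trans (hmono n k hn hk)
    obtain ⟨s₀, hs₀⟩ := hE.1
    obtain ⟨s₁, hs₁⟩ : ∃ s, E s ≠ 0 := by
      by_contra hall
      push Not at hall
      obtain ⟨n, _, σ, hσ⟩ := hbd 0
      simp [totalEnergy, hall] at hσ
    obtain ⟨h, τ, hadj, hh, hτ⟩ := exists_uphill (y := y) (by omega) hE0 hs₀ hs₁
    -- For `β ≥ 1` the ground state `h` rejects the uphill move to `τ` with at least the probability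
    -- it has at `β = 1`.
    set η := (1 - Real.exp (-1 * (totalEnergy E τ - totalEnergy E h))) * proposalOff γ h τ with hη
    have hη0 : 0 < η := by
      refine mul_pos (sub_pos.2 (Real.exp_lt_one_iff.2 ?_)) (hc0.trans_le (hc h τ hadj))
      linarith
    have hhold : ∀ b, 1 ≤ b → η ≤ metropolis E γ b h h := fun b hb =>
      le_metropolis_self_of_uphill zero_le_one hb (by linarith)
    have hη1 : η ≤ 1 :=
      (hhold 1 le_rfl).trans (le_one_of_mem_rowStochastic (metropolis_stochastic zero_le_one))
    obtain ⟨k₁, hk₁⟩ := eventually_atTop.1 (hlarge 1)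
    refine ⟨max 1 k₁, le_max_left _ _, fun k hk => ?_⟩
    have hk' : ∀ n, k ≤ n → 1 ≤ β n := fun n hn =>
      hk₁ n (((le_max_right _ _).trans hk).trans hn)
    -- Without barriers the long stages need not have unbounded length, so no single stage is known
    -- to contract; instead moves that do not go uphill have probabilities independent of the
    -- temperature. For a positive barrier, `δ exp (β n * m)` eventually exceeds the required `L`.
    by_cases hm : barrier E y ≤ 0
    · refine forgets_of_boundedBelow (h := h) (ε := min c η)
        (lt_min hc0 hη0) ((min_le_left _ _).trans hc1) (Or.inr ⟨rfl, rfl⟩)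
        (reflTransGen_of_barrier_nonpos hm hh) (fun n hn => ?_) hT1
      have hβn := hk' n hn
      refine boundedBelow_metropolis (h := h) (C := 0) (zero_le_one.trans hβn) hc hc0.le
        ((min_le_right _ _).trans (hhold _ hβn)) (by simp)
        fun σ ρ hR => hR.imp_left fun hd => ⟨hd.1, ?_⟩
      rw [max_eq_right (sub_nonpos.2 hd.2), mul_zero]
    · push Not at hm
      obtain ⟨L, r, hr0, hr1, hL⟩ := exists_contracts_metropolis_pow (γ := γ) hE0 hh zero_le_one
        hη0 hη1 hhold hδ
      refine forgets_of_frequently (fun n hn => pow_mem (metropolis_stochastic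
        (zero_le_one.trans (hk' n hn))) _) hr0 hr1 ?_
      refine (hT.and_eventually ((hlarge 1).and (hlarge (L / (δ * barrier E y))))).mono ?_
      rintro n ⟨hn, hn1, hn2⟩
      have hpos := Real.exp_pos (β n * barrier E y)
      have h1 : δ * Real.exp (β n * barrier E y) ≤ T n := by
        rw [neg_mul, Real.exp_neg, ← div_eq_mul_inv, le_div_iff₀ hpos] at hn
        exact hn
      refine hL _ hn1 (T n) ?_ h1
      have h2 : (L : ℝ) ≤ β n * (δ * barrier E y) := (div_le_iff₀ (by positivity)).1 hn2
      have h3 := Real.add_one_le_exp (β n * barrier E y)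
      have h4 : (L : ℝ) ≤ T n := by nlinarith
      exact_mod_cast h4

/-- If `f n < δ` from some point on, the bracket would increase from there and could not tend to
`-∞`. -/
lemma frequently_of_tendsto_atBot {f : ℕ → ℝ} {δ : ℝ}
    (h : Tendsto (fun n : ℕ => -(∑ k ∈ Finset.Icc 1 n, f k) + n * δ) atTop atBot) :
    ∃ᶠ n in atTop, δ ≤ f n := by
  intro hlt
  obtain ⟨n₀, hn₀⟩ := eventually_atTop.1 hlt
  have key : ∀ n, n₀ ≤ n → -(∑ k ∈ Finset.Icc 1 n₀, f k) + n₀ * δ ≤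
      -(∑ k ∈ Finset.Icc 1 n, f k) + n * δ := by
    intro n hn
    induction hn with
    | refl => exact le_rfl
    | @step i hi ih =>
      rw [Nat.succ_eq_add_one, Finset.sum_Icc_succ_top (by omega)]
      have := not_le.1 (hn₀ (i + 1) (Nat.le_succ_of_le hi))
      push_cast
      linarith
  obtain ⟨n, hn, hlt'⟩ := ((eventually_ge_atTop n₀).and
    (h.eventually_lt_atBot (-(∑ k ∈ Finset.Icc 1 n₀, f k) + n₀ * δ))).exists
  exact absurd (key n hn) (not_le.2 hlt')

/-! ### The zero-temperature limit and convergence of the laws -/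

/-- The zero-temperature limit of `Qbar`. -/
def QbarLimit (E : Spin N → ℝ) (γ : ℝ) (σ : Config N y) : ℝ :=
  (zeroSet E y).indicator (mu0 γ) σ / ∑ τ, (zeroSet E y).indicator (mu0 γ) τ

lemma sum_indicator_pos {h : Config N y} (hh : totalEnergy E h = 0) :
    0 < ∑ τ, (zeroSet E y).indicator (mu0 γ) τ := by
  refine Finset.sum_pos' (fun τ _ => Set.indicator_nonneg (fun x _ => (mu0_pos γ x).le) τ)
    ⟨h, Finset.mem_univ h, ?_⟩
  rw [Set.indicator_of_mem (show h ∈ zeroSet E y from hh)]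
  exact mu0_pos γ h

lemma tendsto_gibbsWeight (hE : ∀ s, 0 ≤ E s) {β : ℕ → ℝ} (hβ : Tendsto β atTop atTop)
    (σ : Config N y) : Tendsto (fun n => gibbsWeight E γ (β n) σ) atTop
      (𝓝 ((zeroSet E y).indicator (mu0 γ) σ)) := by
  by_cases hσ : totalEnergy E σ = 0
  · rw [Set.indicator_of_mem (show σ ∈ zeroSet E y from hσ)]
    simp only [gibbsWeight, hσ, mul_zero, Real.exp_zero, one_mul]
    exact tendsto_const_nhds
  · rw [Set.indicator_of_notMem (show σ ∉ zeroSet E y from hσ)]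
    have hpos := (totalEnergy_nonneg hE σ).lt_of_ne' hσ
    have h1 : Tendsto (fun n => -β n * totalEnergy E σ) atTop atBot :=
      (tendsto_neg_atTop_atBot.comp hβ).atBot_mul_const hpos
    simpa [gibbsWeight] using (Real.tendsto_exp_atBot.comp h1).mul_const (mu0 γ σ)

lemma tendsto_Qbar (hE : ∀ s, 0 ≤ E s) {β : ℕ → ℝ} (hβ : Tendsto β atTop atTop)
    {h : Config N y} (hh : totalEnergy E h = 0) :
    Tendsto (fun n => (Qbar E γ (β n) : Config N y → ℝ)) atTop (𝓝 (QbarLimit E γ)) :=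
  tendsto_pi_nhds.2 fun σ => (tendsto_gibbsWeight hE hβ σ).div
    (tendsto_finsetSum _ fun τ _ => tendsto_gibbsWeight hE hβ τ) (sum_indicator_pos hh).ne'

lemma QbarLimit_mem_stdSimplex {h : Config N y} (hh : totalEnergy E h = 0) :
    (QbarLimit E γ : Config N y → ℝ) ∈ stdSimplex ℝ (Config N y) := by
  refine ⟨fun σ => div_nonneg (Set.indicator_nonneg (fun x _ => (mu0_pos γ x).le) σ)
    (sum_indicator_pos hh).le, ?_⟩
  simp only [QbarLimit, ← Finset.sum_div]
  exact div_self (sum_indicator_pos hh).ne'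

lemma sum_law {β : ℕ → ℝ} (hβ₀ : ∀ n, 1 ≤ n → 0 ≤ β n) {T : ℕ → ℕ} {ν₀ : Config N y → ℝ}
    (hν₀ : ∑ σ, ν₀ σ = 1) (n : ℕ) : ∑ σ, law E γ β T ν₀ n σ = 1 := by
  induction n with
  | zero => exact hν₀
  | succ n ih =>
    rw [← ih]
    exact sum_vecMul_of_stochastic (pow_mem (metropolis_stochastic (hβ₀ _ (by omega))) _) _

lemma Qbar_vecMul_metropolis_pow {β : ℝ} (hβ : 0 ≤ β) (n : ℕ) :
    (Qbar E γ β : Config N y → ℝ) ᵥ* metropolis E γ β ^ n = Qbar E γ β := by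
  induction n with
  | zero => rw [pow_zero, vecMul_one]
  | succ n ih => rw [pow_succ', ← vecMul_vecMul, Qbar_vecMul_metropolis hβ, ih]

/-- Strong ergodicity is applied with one matrix per stage, namely the power `T n` of the kernel;
the ℓ¹ norm dominates the supremum norm. -/
lemma tendsto_norm_Qbar_sub_law (hy : 2 ≤ y) (hγ : 0 < γ) (hE : IsLeast (Set.range E) 0)
    {β : ℕ → ℝ} (hβ₀ : ∀ n, 1 ≤ n → 0 ≤ β n) (hβ : ∀ n, 1 ≤ n → β n ≤ β (n + 1)) {T : ℕ → ℕ}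
    {ν₀ : Config N y → ℝ} (hν₀ : ν₀ ∈ stdSimplex ℝ (Config N y)) {δ : ℝ}
    (hδ : 0 < δ) (hT : ∃ᶠ n in atTop, δ ≤ T n * Real.exp (-β n * barrier E y)) :
    Tendsto (fun n => ‖Qbar E γ (β n) - law E γ β T ν₀ n‖) atTop (𝓝 0) := by
  obtain ⟨s₀, hs₀⟩ := hE.1
  have hh : totalEnergy E (fun _ => s₀ : Config N y) = 0 := by simp [totalEnergy, hs₀]
  obtain ⟨k₀, hk₀, hF⟩ := exists_forgets hy hγ hE hβ₀ hβ hδ hT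
  have := tendsto_of_forgets (ν := law E γ β T ν₀) (Q := fun n => Qbar E γ (β n)) (k₀ := k₀)
    (fun n hn => pow_mem (metropolis_stochastic (hβ₀ n (hk₀.trans hn))) _) (fun n => rfl)
    (fun n hn => Qbar_vecMul_metropolis_pow (hβ₀ n (hk₀.trans hn)) _)
    (fun n => by rw [sum_law hβ₀ hν₀.2, sum_Qbar])
    (summable_Qbar_increments (fun s => hE.2 ⟨s, rfl⟩) hβ hh) hF
  refine squeeze_zero (fun n => norm_nonneg _) (fun n => ?_) this
  refine (pi_norm_le_iff_of_nonneg (Finset.sum_nonneg fun _ _ => abs_nonneg _)).2 fun σ => ?_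
  exact Finset.single_le_sum (f := fun σ => |Qbar E γ (β n) σ - law E γ β T ν₀ n σ|)
    (fun _ _ => abs_nonneg _) (Finset.mem_univ σ)

end Convergence

end ReplicatedAnnealing

end

open ReplicatedAnnealing

theorem theorem3p2 (N y : ℕ) (hy : 2 ≤ y)
    (E : ReplicatedAnnealing.Spin N → ℝ) (hE : IsLeast (Set.range E) 0)
    (γ : ℝ) (hγ : 0 < γ)
    (β : ℕ → ℝ) (hβ₀ : ∀ n, 1 ≤ n → 0 ≤ β n) (hβ : ∀ n, 1 ≤ n → β n ≤ β (n + 1))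
    (T : ℕ → ℕ)
    (ν₀ : ReplicatedAnnealing.Config N y → ℝ)
    (hν₀ : ν₀ ∈ stdSimplex ℝ (ReplicatedAnnealing.Config N y)) :
    (∃ κ₁ : ℝ, 1 < κ₁ ∧ ReplicatedAnnealing.IncrementBound E y γ β κ₁) ∧
    ∀ κ₁ : ℝ, 1 < κ₁ → ReplicatedAnnealing.IncrementBound E y γ β κ₁ →
      Tendsto (fun n : ℕ =>
          -(∑ k ∈ Finset.Icc 1 n,
              (T k : ℝ) * Real.exp (-β k * ReplicatedAnnealing.barrier E y))
            + n * Real.log κ₁) atTop atBot →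
      Tendsto (fun n : ℕ =>
          ∑ k ∈ Finset.Icc 1 n,
            (T k : ℝ) * Real.exp (-β k * ReplicatedAnnealing.barrier E y)) atTop atTop ∧
      Tendsto (fun n : ℕ =>
          ‖ReplicatedAnnealing.Qbar E γ (β n) - ReplicatedAnnealing.law E γ β T ν₀ n‖)
        atTop (𝓝 0) ∧
      (Tendsto β atTop atTop →
        ∃ Qinf : ReplicatedAnnealing.Config N y → ℝ,
          Qinf ∈ stdSimplex ℝ (ReplicatedAnnealing.Config N y) ∧
          (∃ c : ℝ, 0 < c ∧ ∀ σ ∈ ReplicatedAnnealing.zeroSet E y,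
            Qinf σ = c * ReplicatedAnnealing.mu0 γ σ) ∧
          (∀ σ, σ ∉ ReplicatedAnnealing.zeroSet E y → Qinf σ = 0) ∧
          Tendsto (fun n : ℕ => (ReplicatedAnnealing.Qbar E γ (β n) :
            ReplicatedAnnealing.Config N y → ℝ)) atTop (𝓝 Qinf) ∧
          Tendsto (fun n : ℕ => ReplicatedAnnealing.law E γ β T ν₀ n) atTop (𝓝 Qinf)) := by
  have hE0 : ∀ s, 0 ≤ E s := fun s => hE.2 ⟨s, rfl⟩
  obtain ⟨s₀, hs₀⟩ := hE.1
  have hh : totalEnergy E (fun _ => s₀ : Config N y) = 0 := by simp [totalEnergy, hs₀]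
  refine ⟨exists_incrementBound hE0 hβ₀ hβ hh, fun κ hκ _ hlim => ?_⟩
  have hδ := Real.log_pos hκ
  have hε := tendsto_norm_Qbar_sub_law hy hγ hE hβ₀ hβ hν₀ hδ (frequently_of_tendsto_atBot hlim)
  refine ⟨?_, hε, fun hβlim => ?_⟩
  · refine tendsto_atTop_mono (fun n => ?_) (tendsto_neg_atBot_atTop.comp hlim)
    have : 0 ≤ (n : ℝ) * Real.log κ := by positivity
    simp only [Function.comp_apply]
    linarith
  · have hQ := tendsto_Qbar (γ := γ) hE0 hβlim hh
    refine ⟨QbarLimit E γ, QbarLimit_mem_stdSimplex hh,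
      ⟨_, inv_pos.2 (sum_indicator_pos (γ := γ) hh), fun σ hσ => ?_⟩, fun σ hσ => ?_, hQ, ?_⟩
    · rw [QbarLimit, Set.indicator_of_mem hσ, div_eq_inv_mul]
    · rw [QbarLimit, Set.indicator_of_notMem hσ, zero_div]
    · have := hQ.sub (tendsto_zero_iff_norm_tendsto_zero.2 hε)
      simpa using this
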